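/- Let $Y=(y_1,\dots,y_N)\in\mathbb R^N$ be a nonzero label vector with known norm $\eta_3=\|Y\|$, and let the $N$ examples be assigned to the $k^D$ leaves of a tree of depth $D$ so that every leaf cluster $\mathcal C_j$ is non-empty. Put $\mathrm{label}_j=\frac1{|\mathcal C_j|}\sum_{i\in\mathcal C_j}y_i$. Let $|i\rangle$, $i\in[N]$, be encoded as distinct computational basis states of an $n$-qubit register, and let $$|\xi_j\rangle=\frac1{\sqrt{|\mathcal C_j|}}\sum_{i\in\mathcal C_j}|i\rangle,\qquad |Y\rangle=\frac1{\|Y\|}\sum_{i=1}^N y_i|i\rangle .$$ A quantum algorithm has access to subroutines, i.e. unitaries on $n$ qubits that map $|0\cdots0\rangle$ to $|\xi_j\rangle$ ($j\in[k^D]$) and to $|Y\rangle$, respectively, and whose action on other inputs is unspecified. Each use of such a subroutine or of its inverse, possibly controlled on one qubit, takes time $T_\xi\ge1$ for $|\xi_j\rangle$ and time $T_Y\geq 0$ for $|Y\rangle$. All other steps are one-qubit gates with at most two controls, of time $1$ each; initialising, measuring and reading a qubit takes time $1$ in all, and the output is computed from the measured bits. The algorithm depends on $N,n,k,D,\eta_3$,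 the precision and the failure probability only; the clusters and labels enter only through the subroutines. Assume $T_Y=O(T_\xi)$ and $n=O(T_\xi)$. Then for every $\epsilon_3>0$ there is a quantum algorithm that runs in time $$T_{\text{leaf-label}}=O\!\left(\frac{T_\xi\,k^D\,\eta_3}{\epsilon_3}\right)$$ and outputs estimates $\overline{\mathrm{label}_j}$, $j\in[k^D]$, such that for every $j\in[k^D]$, with probability at least $8/\pi^2$, $|\overline{\mathrm{label}_j}-\mathrm{label}_j|\le\epsilon_3$. Moreover, for every $\epsilon_3>0$ and $0<\Delta\le\frac12$ there is a quantum algorithm that runs in time $O\!\left(\frac{T_\xi k^D\eta_3}{\epsilon_3}\log\frac{k^D}{\Delta}\right)$ and whose estimates satisfy, with probability at least $1-\Delta$, $|\overline{\mathrm{label}_j}-\mathrm{label}_j|\le\epsilon_3$ for all $j\in[k^D]$ simultaneously. The constants in these two time bounds depend only on the constants in $T_Y=O(T_\xi)$ and $n=O(T_\xi)$. -/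

import Mathlib

open scoped Matrix

noncomputable section

namespace LeafLabel

/-- Contents of `n` (qu)bits; also the labels of the computational basis of `n` qubits. -/
abbrev Bits (n : ℕ) : Type := Fin n → Bool

/-- The basis state `|0…0⟩` of `n` qubits. -/
def zeroKet (n : ℕ) : Bits n → ℂ := Pi.single (fun _ => false) 1

/-! ### The data -/

/-- The cluster of leaf `j`, for the leaf assignment `leaf` of the `N` examples. -/
def cluster {N m : ℕ} (leaf : Fin N → Fin m) (j : Fin m) : Finset (Fin N) :=
  Finset.univ.filter fun i => leaf i = j

/-- The mean label `label_j = (1 / |C_j|) ∑_{i ∈ C_j} y_i` of leaf `j`. -/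
def meanLabel {N m : ℕ} (Y : EuclideanSpace ℝ (Fin N)) (leaf : Fin N → Fin m) (j : Fin m) : ℝ :=
  (∑ i ∈ cluster leaf j, Y i) / ((cluster leaf j).card : ℝ)

/-- The characteristic state `|ξ_j⟩ = |C_j|^{-1/2} ∑_{i ∈ C_j} |i⟩`, where `|i⟩` is the basis
state `idx i` of the `n`-qubit index register. -/
def charState {N m n : ℕ} (idx : Fin N ↪ Bits n) (leaf : Fin N → Fin m) (j : Fin m) :
    Bits n → ℂ :=
  ∑ i ∈ cluster leaf j, Pi.single (idx i) ((1 / Real.sqrt ((cluster leaf j).card : ℝ) : ℝ) : ℂ)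

/-- The label state `|Y⟩ = ‖Y‖⁻¹ ∑_i y_i |i⟩`. -/
def labelState {N n : ℕ} (idx : Fin N ↪ Bits n) (Y : EuclideanSpace ℝ (Fin N)) : Bits n → ℂ :=
  ∑ i, Pi.single (idx i) ((Y i / ‖Y‖ : ℝ) : ℂ)

/-! ### Quantum circuits with preparation subroutines -/

/-- State preparation subroutines: for each leaf a unitary on the `n`-qubit index register, and
one more unitary for the labels. -/
structure Preparers (n m : ℕ) where
  char : Fin m → Matrix.unitaryGroup (Bits n) ℂ
  label : Matrix.unitaryGroup (Bits n) ℂ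

/-- The subroutines prepare the characteristic states and the label state from `|0…0⟩`;
nothing is said about their action on other inputs. -/
def Preparers.Prepare {N n m : ℕ} (P : Preparers n m) (idx : Fin N ↪ Bits n)
    (Y : EuclideanSpace ℝ (Fin N)) (leaf : Fin N → Fin m) : Prop :=
  (∀ j, ((P.char j : Matrix (Bits n) (Bits n) ℂ) *ᵥ zeroKet n) = charState idx leaf j) ∧
    ((P.label : Matrix (Bits n) (Bits n) ℂ) *ᵥ zeroKet n) = labelState idx Y

/-- One step of a circuit on `w` qubits. `S` is a set of control qubits disjoint from the target.
* `elem`: a one-qubit unitary on qubit `q`, with at most two controls;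
* `char`: the preparation of `|ξ_j⟩` (or its inverse) on the qubits `e 0, …, e (n-1)`, with at
  most one control;
* `label`: the same for the preparation of `|Y⟩`. -/
inductive Gate (n m w : ℕ) : Type
  | elem (V : Matrix.unitaryGroup Bool ℂ) (q : Fin w) (S : Finset (Fin w))
      (hS : S.card ≤ 2) (hq : q ∉ S) : Gate n m w
  | char (j : Fin m) (inverse : Bool) (e : Fin n ↪ Fin w) (S : Finset (Fin w))
      (hS : S.card ≤ 1) (he : ∀ a, e a ∉ S) : Gate n m w
  | label (inverse : Bool) (e : Fin n ↪ Fin w) (S : Finset (Fin w))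
      (hS : S.card ≤ 1) (he : ∀ a, e a ∉ S) : Gate n m w

/-- The action on a `w`-qubit state of the one-qubit operator `V` on qubit `q`, controlled
on `S`. -/
def applyQubit {w : ℕ} (V : Matrix Bool Bool ℂ) (q : Fin w) (S : Finset (Fin w))
    (ψ : Bits w → ℂ) : Bits w → ℂ := fun x =>
  if ∀ s ∈ S, x s = true then ∑ b : Bool, V (x q) b * ψ (Function.update x q b) else ψ x

/-- The action on a `w`-qubit state of the `n`-qubit operator `V` on the qubits `e 0, …, e (n-1)`,
controlled on `S`. Here `Function.extend e z x` is `x` with the bits at these positions replaced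
by `z`. -/
def applyRegister {n w : ℕ} (V : Matrix (Bits n) (Bits n) ℂ) (e : Fin n ↪ Fin w)
    (S : Finset (Fin w)) (ψ : Bits w → ℂ) : Bits w → ℂ := fun x =>
  if ∀ s ∈ S, x s = true then ∑ z : Bits n, V (x ∘ e) z * ψ (Function.extend e z x) else ψ x

/-- The unitary, or its inverse. -/
def orInverse {n : ℕ} (inverse : Bool) (U : Matrix.unitaryGroup (Bits n) ℂ) :
    Matrix (Bits n) (Bits n) ℂ :=
  if inverse then ((U⁻¹ : Matrix.unitaryGroup (Bits n) ℂ) : Matrix (Bits n) (Bits n) ℂ)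
  else (U : Matrix (Bits n) (Bits n) ℂ)

/-- The action of one circuit step on a state. -/
def Gate.apply {n m w : ℕ} (P : Preparers n m) : Gate n m w → (Bits w → ℂ) → (Bits w → ℂ)
  | .elem V q S _ _, ψ => applyQubit (V : Matrix Bool Bool ℂ) q S ψ
  | .char j inverse e S _ _, ψ => applyRegister (orInverse inverse (P.char j)) e S ψ
  | .label inverse e S _ _, ψ => applyRegister (orInverse inverse P.label) e S ψ

/-- The time of one circuit step: `1` for an elementary gate, `Tξ` for a use of a characteristic
state preparation, `TY` for a use of the label state preparation. -/
def Gate.cost {n m w : ℕ} (Tξ TY : ℝ) : Gate n m w → ℝ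
  | .elem .. => 1
  | .char .. => Tξ
  | .label .. => TY

/-- The final state of a circuit (a list of steps, executed from left to right) started
in `|0…0⟩`. -/
def finalState {n m w : ℕ} (P : Preparers n m) (c : List (Gate n m w)) : Bits w → ℂ :=
  c.foldl (fun ψ g => g.apply P ψ) (zeroKet w)

/-- A quantum algorithm that outputs `m` real numbers: it runs finitely many circuits, each one
on fresh qubits in state `|0…0⟩`, measures all qubits at the end of each run, and computes its
outputs from the measured bits. The data enter through the preparation subroutines only. -/
structure Algorithm (n m : ℕ) where
  runs : ℕ
  width : Fin runs → ℕ
  circuit : (r : Fin runs) → List (Gate n m (width r))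
  post : ((r : Fin runs) → Bits (width r)) → Fin m → ℝ

/-- The running time: the time of all circuit steps, plus one unit for each qubit that is
initialised, measured and read by the classical post-processing (a decision tree that queries
each measured bit once). -/
def Algorithm.time {n m : ℕ} (𝒜 : Algorithm n m) (Tξ TY : ℝ) : ℝ :=
  ∑ r, ((𝒜.width r : ℝ) + ((𝒜.circuit r).map (Gate.cost Tξ TY)).sum)

open Classical in
/-- The probability that the output of the algorithm satisfies `E`: the runs are independent and
each one is measured in the computational basis. -/
def Algorithm.prob {n m : ℕ} (𝒜 : Algorithm n m) (P : Preparers n m)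
    (E : (Fin m → ℝ) → Prop) : ℝ :=
  ∑ x : (r : Fin 𝒜.runs) → Bits (𝒜.width r),
    if E (𝒜.post x) then ∏ r, ‖finalState P (𝒜.circuit r) (x r)‖ ^ 2 else 0

end LeafLabel

end

/-! Write a = label_j / ‖Y‖, a number in [-1, 1]. One copy of |ξ_j⟩ has overlap √|C_j| · a with |Y⟩,
which involves the unknown cluster size. Two copies |ξ_j⟩|ξ_j⟩ against the copied label state ∑ (y_i
/ ‖Y‖) |i⟩|i⟩ have overlap exactly a (`sum_charState_mul_labelState`). A control qubit puts these
two states in superposition with amplitudes 12/13 and 5/13. An observable of square 1 on that qubit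
then has expectation cos θ = (2856 + 840 a) / 4225 (`expectation_prepCircuit`).

Let B be this observable conjugated by the preparation circuit and R the reflection in |0…0⟩. Then
B² = 1 and ⟨0|B|0⟩ = cos θ, so the Chebyshev recurrence gives ⟨0|(BR)^s|0⟩ = cos(sθ)
(`apply_pow_mul_reflection`, `finalState_amplification`). A run of s rounds therefore returns all
zeros with probability cos²(sθ).

Phase estimation is not needed. The probabilities are estimated to constant accuracy for s = 2^k and
s = 2^k + 1, k ≤ K, and any number that fits all the frequencies is output. Two such numbers differ
by at most 3 / 2^K: each scale halves the error, and the previous scale excludes aliasing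
(`abs_sub_le_of_abs_cos_sub_cos_le`). Hence 2^K of order ‖Y‖ / ε suffices.

Scale k is repeated in proportion to L + (K - k). The failure probabilities then sum to at most
exp(-L) per leaf (`sum_exp_repetitions_le`), while the cost ∑ 2^k (L + K - k) stays O(2^K L), with
no additional logarithm of the precision (`estimator_time_le`). A constant L gives the bound for
each leaf, and L of order log(k^D / Δ) with a union bound gives the simultaneous one. -/

noncomputable section

namespace LeafLabel

/-! ### Gates as unitary operators -/

theorem extend_comp_self {n w : ℕ} (e : Fin n ↪ Fin w) (z : Bits n) (x : Bits w) :
    Function.extend e z x ∘ e = z := by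
  funext a
  exact e.injective.extend_apply z x a

theorem extend_extend {n w : ℕ} (e : Fin n ↪ Fin w) (z z' : Bits n) (x : Bits w) :
    Function.extend e z (Function.extend e z' x) = Function.extend e z x := by
  funext q
  by_cases h : ∃ a, e a = q
  · obtain ⟨a, rfl⟩ := h
    simp [e.injective.extend_apply]
  · simp [Function.extend_apply' _ _ _ h]

theorem extend_comp_eq {n w : ℕ} (e : Fin n ↪ Fin w) (x : Bits w) :
    Function.extend e (x ∘ e) x = x := by
  funext q
  by_cases h : ∃ a, e a = q
  · obtain ⟨a, rfl⟩ := h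
    simp [e.injective.extend_apply]
  · simp [Function.extend_apply' _ _ _ h]

theorem extend_apply_of_forall_ne {n w : ℕ} (e : Fin n ↪ Fin w) (z : Bits n) (x : Bits w)
    {q : Fin w} (h : ∀ a, e a ≠ q) : Function.extend e z x q = x q :=
  Function.extend_apply' _ _ _ fun ⟨a, ha⟩ => h a ha

theorem forall_control_extend {n w : ℕ} (e : Fin n ↪ Fin w) {S : Finset (Fin w)}
    (he : ∀ a, e a ∉ S) (z : Bits n) (x : Bits w) :
    (∀ s ∈ S, Function.extend e z x s = true) ↔ ∀ s ∈ S, x s = true := by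
  refine forall₂_congr fun s hs => ?_
  rw [extend_apply_of_forall_ne]
  rintro a rfl
  exact he a hs

theorem applyRegister_mul {n w : ℕ} (V V' : Matrix (Bits n) (Bits n) ℂ) (e : Fin n ↪ Fin w)
    {S : Finset (Fin w)} (he : ∀ a, e a ∉ S) (ψ : Bits w → ℂ) :
    applyRegister V e S (applyRegister V' e S ψ) = applyRegister (V * V') e S ψ := by
  funext x
  by_cases hx : ∀ s ∈ S, x s = true
  · simp only [applyRegister, forall_control_extend e he, if_pos hx, extend_extend,
      extend_comp_self, Matrix.mul_apply, Finset.mul_sum, Finset.sum_mul]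
    rw [Finset.sum_comm]
    simp only [mul_assoc]
  · simp only [applyRegister, if_neg hx]

theorem applyRegister_one {n w : ℕ} (e : Fin n ↪ Fin w) (S : Finset (Fin w)) (ψ : Bits w → ℂ) :
    applyRegister 1 e S ψ = ψ := by
  funext x
  simp [applyRegister, Matrix.one_apply, extend_comp_eq]

/-- Exchanging the register content of x with z is an involution on pairs (x, z) that swaps the row
and column indices of V. It preserves the control condition because the register avoids `S`. -/
theorem dotProduct_applyRegister {n w : ℕ} (V : Matrix (Bits n) (Bits n) ℂ) (e : Fin n ↪ Fin w)
    {S : Finset (Fin w)} (he : ∀ a, e a ∉ S) (φ ψ : Bits w → ℂ) :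
    star (applyRegister V e S φ) ⬝ᵥ ψ = star φ ⬝ᵥ applyRegister Vᴴ e S ψ := by
  have key : ∑ p : Bits w × Bits n, (if ∀ s ∈ S, p.1 s = true then
        star (V (p.1 ∘ e) p.2) * star (φ (Function.extend e p.2 p.1)) * ψ p.1 else 0) =
      ∑ p : Bits w × Bits n, (if ∀ s ∈ S, p.1 s = true then
        star (φ p.1) * (star (V p.2 (p.1 ∘ e)) * ψ (Function.extend e p.2 p.1)) else 0) := by
    refine Finset.sum_nbij' (fun p => (Function.extend e p.2 p.1, p.1 ∘ e))
      (fun p => (Function.extend e p.2 p.1, p.1 ∘ e)) (by simp) (by simp) ?_ ?_ ?_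
    · rintro ⟨x, z⟩ -
      simp [extend_extend, extend_comp_eq, extend_comp_self]
    · rintro ⟨x, z⟩ -
      simp [extend_extend, extend_comp_eq, extend_comp_self]
    · rintro ⟨x, z⟩ -
      simp only [extend_extend, extend_comp_eq, extend_comp_self, forall_control_extend e he]
      split_ifs
      · ring
      · rfl
  rw [Fintype.sum_prod_type, Fintype.sum_prod_type] at key
  have split : ∀ f g : Bits w → ℂ, ∑ x, (if ∀ s ∈ S, x s = true then f x else g x) =
      ∑ x, (if ∀ s ∈ S, x s = true then f x else 0) +
        ∑ x, (if ∀ s ∈ S, x s = true then 0 else g x) := by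
    intro f g
    rw [← Finset.sum_add_distrib]
    refine Finset.sum_congr rfl fun x _ => ?_
    split_ifs <;> simp
  have h₁ : star (applyRegister V e S φ) ⬝ᵥ ψ =
      ∑ x, if ∀ s ∈ S, x s = true then
        ∑ z, star (V (x ∘ e) z) * star (φ (Function.extend e z x)) * ψ x
        else star (φ x) * ψ x := by
    refine Finset.sum_congr rfl fun x _ => ?_
    simp only [Pi.star_apply, applyRegister]
    split_ifs
    · simp only [star_sum, star_mul', Finset.sum_mul]
    · rfl
  have h₂ : star φ ⬝ᵥ applyRegister Vᴴ e S ψ =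
      ∑ x, if ∀ s ∈ S, x s = true then
        ∑ z, star (φ x) * (star (V z (x ∘ e)) * ψ (Function.extend e z x))
        else star (φ x) * ψ x := by
    refine Finset.sum_congr rfl fun x _ => ?_
    simp only [Pi.star_apply, applyRegister]
    split_ifs
    · simp only [Finset.mul_sum, Matrix.conjTranspose_apply]
    · rfl
  rw [h₁, h₂, split, split (fun x => ∑ z, star (φ x) * _)]
  congr 1
  refine Eq.trans (Finset.sum_congr rfl fun x _ => ?_)
    (key.trans (Finset.sum_congr rfl fun x _ => ?_))
  · split_ifs <;> simp
  · split_ifs <;> simp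

/-- The one-bit register consisting of qubit `q`. -/
def singleQubit {w : ℕ} (q : Fin w) : Fin 1 ↪ Fin w :=
  ⟨fun _ => q, fun a b _ => Subsingleton.elim a b⟩

/-- Reduces elementary gates to register operators, so that composition, adjoints and linearity need
only one proof. -/
theorem applyQubit_eq_applyRegister {w : ℕ} (V : Matrix Bool Bool ℂ) (q : Fin w)
    (S : Finset (Fin w)) (ψ : Bits w → ℂ) :
    applyQubit V q S ψ = applyRegister
      (V.submatrix (Equiv.funUnique (Fin 1) Bool) (Equiv.funUnique (Fin 1) Bool))
      (singleQubit q) S ψ := by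
  funext x
  simp only [applyQubit, applyRegister]
  split_ifs
  · rw [← (Equiv.funUnique (Fin 1) Bool).symm.sum_comp]
    refine Finset.sum_congr rfl fun b _ => ?_
    congr 2
    funext r
    by_cases h : r = q
    · subst h
      have := (singleQubit r).injective.extend_apply ((Equiv.funUnique (Fin 1) Bool).symm b) x 0
      simp only [Function.update_self]
      exact this.symm
    · rw [extend_apply_of_forall_ne _ _ _ (fun _ => Ne.symm h)]
      simp [h]
  · rfl

theorem applyQubit_mul {w : ℕ} (V V' : Matrix Bool Bool ℂ) {q : Fin w} {S : Finset (Fin w)}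
    (hq : q ∉ S) (ψ : Bits w → ℂ) :
    applyQubit V q S (applyQubit V' q S ψ) = applyQubit (V * V') q S ψ := by
  simp only [applyQubit_eq_applyRegister]
  rw [applyRegister_mul _ _ _ (fun _ => hq), Matrix.submatrix_mul_equiv]

theorem applyQubit_one {w : ℕ} (q : Fin w) (S : Finset (Fin w)) (ψ : Bits w → ℂ) :
    applyQubit 1 q S ψ = ψ := by
  rw [applyQubit_eq_applyRegister, Matrix.submatrix_one_equiv, applyRegister_one]

theorem dotProduct_applyQubit {w : ℕ} (V : Matrix Bool Bool ℂ) {q : Fin w} {S : Finset (Fin w)}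
    (hq : q ∉ S) (φ ψ : Bits w → ℂ) :
    star (applyQubit V q S φ) ⬝ᵥ ψ = star φ ⬝ᵥ applyQubit Vᴴ q S ψ := by
  simp only [applyQubit_eq_applyRegister]
  rw [dotProduct_applyRegister _ _ (fun _ => hq), Matrix.conjTranspose_submatrix]

/-- The gate that undoes `g`. -/
def Gate.inv {n m w : ℕ} : Gate n m w → Gate n m w
  | .elem V q S hS hq => .elem V⁻¹ q S hS hq
  | .char j i e S hS he => .char j (!i) e S hS he
  | .label i e S hS he => .label (!i) e S hS he

theorem orInverse_not {n : ℕ} (i : Bool) (U : Matrix.unitaryGroup (Bits n) ℂ) :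
    orInverse (!i) U = (orInverse i U)ᴴ := by
  cases i
  · rfl
  · exact (Matrix.conjTranspose_conjTranspose (U : Matrix (Bits n) (Bits n) ℂ)).symm

theorem orInverse_not_mul {n : ℕ} (i : Bool) (U : Matrix.unitaryGroup (Bits n) ℂ) :
    orInverse (!i) U * orInverse i U = 1 := by
  cases i
  · exact congrArg Subtype.val (inv_mul_cancel U)
  · exact congrArg Subtype.val (mul_inv_cancel U)

theorem Gate.inv_apply_apply {n m w : ℕ} (P : Preparers n m) (g : Gate n m w) (ψ : Bits w → ℂ) :
    g.inv.apply P (g.apply P ψ) = ψ := by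
  cases g with
  | elem V q S hS hq =>
    have h : ((V⁻¹ : Matrix.unitaryGroup Bool ℂ) : Matrix Bool Bool ℂ) * V = 1 :=
      congrArg Subtype.val (inv_mul_cancel V)
    simp only [Gate.inv, Gate.apply]
    rw [applyQubit_mul _ _ hq, h, applyQubit_one]
  | char j i e S hS he =>
    simp only [Gate.inv, Gate.apply]
    rw [applyRegister_mul _ _ _ he, orInverse_not_mul, applyRegister_one]
  | label i e S hS he =>
    simp only [Gate.inv, Gate.apply]
    rw [applyRegister_mul _ _ _ he, orInverse_not_mul, applyRegister_one]

theorem Gate.dotProduct_apply {n m w : ℕ} (P : Preparers n m) (g : Gate n m w)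
    (φ ψ : Bits w → ℂ) : star (g.apply P φ) ⬝ᵥ ψ = star φ ⬝ᵥ g.inv.apply P ψ := by
  cases g with
  | elem V q S hS hq => exact dotProduct_applyQubit _ hq φ ψ
  | char j i e S hS he =>
    simp only [Gate.inv, Gate.apply, orInverse_not]
    exact dotProduct_applyRegister _ _ he φ ψ
  | label i e S hS he =>
    simp only [Gate.inv, Gate.apply, orInverse_not]
    exact dotProduct_applyRegister _ _ he φ ψ

theorem Gate.cost_inv {n m w : ℕ} (Tξ TY : ℝ) (g : Gate n m w) :
    g.inv.cost Tξ TY = g.cost Tξ TY := by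
  cases g <;> rfl

theorem applyRegister_add {n w : ℕ} (V : Matrix (Bits n) (Bits n) ℂ) (e : Fin n ↪ Fin w)
    (S : Finset (Fin w)) (φ ψ : Bits w → ℂ) :
    applyRegister V e S (φ + ψ) = applyRegister V e S φ + applyRegister V e S ψ := by
  funext x
  simp only [applyRegister, Pi.add_apply]
  split_ifs
  · simp only [mul_add, Finset.sum_add_distrib]
  · rfl

theorem applyRegister_smul {n w : ℕ} (V : Matrix (Bits n) (Bits n) ℂ) (e : Fin n ↪ Fin w)
    (S : Finset (Fin w)) (c : ℂ) (ψ : Bits w → ℂ) :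
    applyRegister V e S (c • ψ) = c • applyRegister V e S ψ := by
  funext x
  simp only [applyRegister, Pi.smul_apply, smul_eq_mul]
  split_ifs
  · simp only [Finset.mul_sum, mul_left_comm]
  · rfl

theorem Gate.apply_add {n m w : ℕ} (P : Preparers n m) (g : Gate n m w) (φ ψ : Bits w → ℂ) :
    g.apply P (φ + ψ) = g.apply P φ + g.apply P ψ := by
  cases g <;> simp only [Gate.apply, applyQubit_eq_applyRegister, applyRegister_add]

theorem Gate.apply_smul {n m w : ℕ} (P : Preparers n m) (g : Gate n m w) (c : ℂ)
    (ψ : Bits w → ℂ) : g.apply P (c • ψ) = c • g.apply P ψ := by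
  cases g <;> simp only [Gate.apply, applyQubit_eq_applyRegister, applyRegister_smul]

/-! ### Circuits as unitary operators -/

/-- The operator of a circuit. -/
def run {n m w : ℕ} (P : Preparers n m) : List (Gate n m w) → (Bits w → ℂ) →ₗ[ℂ] (Bits w → ℂ)
  | [] => LinearMap.id
  | g :: c => run P c ∘ₗ
      { toFun := g.apply P, map_add' := g.apply_add P, map_smul' := g.apply_smul P }

@[simp] theorem run_nil {n m w : ℕ} (P : Preparers n m) (ψ : Bits w → ℂ) :
    run P ([] : List (Gate n m w)) ψ = ψ := rfl

@[simp] theorem run_cons {n m w : ℕ} (P : Preparers n m) (g : Gate n m w) (c : List (Gate n m w))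
    (ψ : Bits w → ℂ) : run P (g :: c) ψ = run P c (g.apply P ψ) := rfl

theorem run_append {n m w : ℕ} (P : Preparers n m) (c d : List (Gate n m w))
    (ψ : Bits w → ℂ) : run P (c ++ d) ψ = run P d (run P c ψ) := by
  induction c generalizing ψ with
  | nil => rfl
  | cons g c ih => simp [ih]

theorem finalState_eq_run {n m w : ℕ} (P : Preparers n m) (c : List (Gate n m w)) :
    finalState P c = run P c (zeroKet w) := by
  unfold finalState
  generalize zeroKet w = ψ
  induction c generalizing ψ with
  | nil => rfl
  | cons g c ih => simp [ih]

/-- The circuit that undoes `c`. -/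
def invCircuit {n m w : ℕ} (c : List (Gate n m w)) : List (Gate n m w) :=
  (c.map Gate.inv).reverse

theorem run_invCircuit_run {n m w : ℕ} (P : Preparers n m) (c : List (Gate n m w))
    (ψ : Bits w → ℂ) : run P (invCircuit c) (run P c ψ) = ψ := by
  induction c generalizing ψ with
  | nil => rfl
  | cons g c ih =>
    have h : invCircuit (g :: c) = invCircuit c ++ [g.inv] := by simp [invCircuit]
    rw [h, run_append, run_cons P g, ih, run_cons, run_nil, Gate.inv_apply_apply]

theorem dotProduct_run {n m w : ℕ} (P : Preparers n m) (c : List (Gate n m w))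
    (φ ψ : Bits w → ℂ) : star (run P c φ) ⬝ᵥ ψ = star φ ⬝ᵥ run P (invCircuit c) ψ := by
  induction c generalizing φ with
  | nil => rfl
  | cons g c ih =>
    have h : invCircuit (g :: c) = invCircuit c ++ [g.inv] := by simp [invCircuit]
    rw [run_cons, ih, Gate.dotProduct_apply, h, run_append, run_cons, run_nil]

theorem sum_cost_invCircuit {n m w : ℕ} (Tξ TY : ℝ) (c : List (Gate n m w)) :
    ((invCircuit c).map (Gate.cost Tξ TY)).sum = (c.map (Gate.cost Tξ TY)).sum := by
  simp only [invCircuit, List.map_reverse, List.sum_reverse, List.map_map]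
  congr 2
  funext g
  exact Gate.cost_inv Tξ TY g

theorem dotProduct_zeroKet {w : ℕ} (ψ : Bits w → ℂ) :
    star (zeroKet w) ⬝ᵥ ψ = ψ fun _ => false := by
  simp [dotProduct, zeroKet, Pi.single_apply, apply_ite star]

theorem sum_norm_sq_eq {w : ℕ} (ψ : Bits w → ℂ) :
    ((∑ x, ‖ψ x‖ ^ 2 : ℝ) : ℂ) = star ψ ⬝ᵥ ψ := by
  simp only [dotProduct, Pi.star_apply, RCLike.star_def, Complex.conj_mul', Complex.ofReal_sum,
    Complex.ofReal_pow]

theorem sum_norm_sq_finalState {n m w : ℕ} (P : Preparers n m) (c : List (Gate n m w)) :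
    ∑ x, ‖finalState P c x‖ ^ 2 = 1 := by
  have h : ((∑ x, ‖finalState P c x‖ ^ 2 : ℝ) : ℂ) = 1 := by
    rw [sum_norm_sq_eq, finalState_eq_run, dotProduct_run, run_invCircuit_run,
      dotProduct_zeroKet]
    simp [zeroKet]
  exact_mod_cast h

/-! ### Products of two reflections -/

/-- BR sends v to Bv and Bv to 2b Bv - v, so it obeys a quadratic equation on the span of v and Bv.
Only the values of R at these two vectors enter, so a circuit for R may be wrong elsewhere. -/
theorem pow_mul_reflection {V : Type*} [AddCommGroup V] [Module ℂ V] (B R : Module.End ℂ V)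
    {v : V} {b : ℂ} (hR : R v = v) (hB : B (B v) = v) (hRB : R (B v) = (2 * b) • v - B v)
    (s : ℕ) : ((B * R) ^ (s + 2)) v = (2 * b) • ((B * R) ^ (s + 1)) v - ((B * R) ^ s) v := by
  have h₁ : (B * R) v = B v := by simp [hR]
  have h₂ : (B * R) (B v) = (2 * b) • B v - v := by simp [hRB, hB]
  rw [pow_succ, pow_succ, Module.End.mul_apply, Module.End.mul_apply, h₁, h₂, map_sub, map_smul,
    Module.End.mul_apply, h₁]

/-- Both sides satisfy the Chebyshev recurrence cos((s+2)θ) = 2 cos θ cos((s+1)θ) - cos(sθ) with the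
same two initial values. -/
theorem apply_pow_mul_reflection {V : Type*} [AddCommGroup V] [Module ℂ V]
    (B R : Module.End ℂ V) (ℓ : V →ₗ[ℂ] ℂ) {v : V} {θ : ℝ} (hR : R v = v) (hB : B (B v) = v)
    (hRB : R (B v) = (2 * (Real.cos θ : ℂ)) • v - B v) (hv : ℓ v = 1)
    (hBv : ℓ (B v) = (Real.cos θ : ℂ)) (s : ℕ) :
    ℓ (((B * R) ^ s) v) = (Real.cos (s * θ) : ℂ) := by
  induction s using Nat.twoStepInduction with
  | zero => simp [hv]
  | one => simpa [hR] using hBv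
  | more s ih₁ ih₂ =>
    rw [pow_mul_reflection B R hR hB hRB, map_sub, map_smul, ih₁, ih₂, smul_eq_mul]
    norm_cast
    have h₁ := Real.cos_add ((s + 1 : ℕ) * θ) θ
    have h₂ := Real.cos_sub ((s + 1 : ℕ) * θ) θ
    have e₁ : ((s + 2 : ℕ) : ℝ) * θ = (s + 1 : ℕ) * θ + θ := by push_cast; ring
    have e₂ : (s : ℝ) * θ = (s + 1 : ℕ) * θ - θ := by push_cast; ring
    rw [e₁, e₂, h₁, h₂]
    ring

/-! ### Elementary gates -/

/-- The one-qubit bit flip. -/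
def bitFlip : Matrix.unitaryGroup Bool ℂ :=
  ⟨Matrix.of fun a b => if a = b then 0 else 1, by
    rw [Matrix.mem_unitaryGroup_iff]
    ext a b
    cases a <;> cases b <;> simp [Matrix.mul_apply]⟩

/-- The effect of a controlled bit flip on the computational basis. -/
def flipBit {w : ℕ} (q : Fin w) (S : Finset (Fin w)) (x : Bits w) : Bits w :=
  if ∀ s ∈ S, x s = true then Function.update x q (!x q) else x

theorem applyQubit_bitFlip {w : ℕ} (q : Fin w) (S : Finset (Fin w)) (ψ : Bits w → ℂ)
    (x : Bits w) : applyQubit (bitFlip : Matrix Bool Bool ℂ) q S ψ x = ψ (flipBit q S x) := by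
  simp only [applyQubit, flipBit, bitFlip]
  split_ifs
  · cases h : x q <;> simp
  · rfl

theorem flipBit_of_ne {w : ℕ} {q r : Fin w} (S : Finset (Fin w)) (x : Bits w) (h : r ≠ q) :
    flipBit q S x r = x r := by
  unfold flipBit
  split_ifs <;> simp [h]

open Classical in
theorem flipBit_self {w : ℕ} (q : Fin w) (S : Finset (Fin w)) (x : Bits w) :
    flipBit q S x q = (x q ^^ decide (∀ s ∈ S, x s = true)) := by
  by_cases h : ∀ s ∈ S, x s = true
  · rw [flipBit, if_pos h, decide_eq_true h]
    simp
  · rw [flipBit, if_neg h, decide_eq_false h]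
    simp

/-- The one-qubit sign flip of `|0⟩`. -/
def signFlip : Matrix.unitaryGroup Bool ℂ :=
  ⟨Matrix.of fun a b => if a = b then (if a then 1 else -1) else 0, by
    rw [Matrix.mem_unitaryGroup_iff]
    ext a b
    cases a <;> cases b <;> simp [Matrix.mul_apply]⟩

theorem applyQubit_signFlip {w : ℕ} (q : Fin w) (ψ : Bits w → ℂ) (x : Bits w) :
    applyQubit (signFlip : Matrix Bool Bool ℂ) q ∅ ψ x = (if x q then 1 else -1) * ψ x := by
  simp only [applyQubit, signFlip]
  cases h : x q <;> simp [← h]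

/-! ### The reflection in `|0…0⟩` -/

section Ladder

variable {n m w L : ℕ} (q : Fin L → Fin w) (t : Fin (L + 1) ↪ Fin w) (hqt : ∀ i j, q i ≠ t j)

/-- The circuit that writes to the clean qubits `t 0, …, t i` whether the qubits before `q 0`,
…, before `q i` are all `0`. -/
def ladder : (i : ℕ) → i ≤ L → List (Gate n m w)
  | 0, _ => [.elem bitFlip (t 0) ∅ (by simp) (by simp)]
  | i + 1, h => ladder i (Nat.le_of_succ_le h) ++
      -- Controls fire on 1 only. The two flips together add t_i ∧ ¬ q_i to t_{i+1}, and no gate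
      -- exceeds two controls.
      [.elem bitFlip (t ⟨i + 1, by omega⟩) {t ⟨i, by omega⟩} (by simp) (by simp),
        .elem bitFlip (t ⟨i + 1, by omega⟩) {t ⟨i, by omega⟩, q ⟨i, h⟩}
          (Finset.card_le_two) (by
            simp only [Finset.mem_insert, EmbeddingLike.apply_eq_iff_eq, Finset.mem_singleton,
              not_or]
            exact ⟨by simp, (hqt _ _).symm⟩)]

/-- Controlled bit flips permute the basis, and `F y` is the input that is carried to y; cleanness
of the work qubits is therefore required of `F y`. The clause on the later work qubits is what the
induction needs: the next flag is written onto a clean qubit. -/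
theorem exists_run_ladder (P : Preparers n m) (i : ℕ) (hi : i ≤ L) :
    ∃ F : Bits w → Bits w, (∀ ψ y, run P (ladder q t hqt i hi) ψ y = ψ (F y)) ∧
      ∀ y, (∀ r, (∀ j, r ≠ t j) → F y r = y r) ∧ ((∀ j, F y (t j) = false) →
        (y (t ⟨i, by omega⟩) = true ↔ ∀ j : Fin L, j.1 < i → y (q j) = false) ∧
          ∀ j : Fin (L + 1), i < j.1 → y (t j) = false) := by
  induction i with
  | zero =>
    refine ⟨flipBit (t 0) ∅, fun ψ y => ?_, fun y => ⟨fun r hr => ?_, fun h => ⟨?_, fun j hj => ?_⟩⟩⟩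
    · simp [ladder, Gate.apply, applyQubit_bitFlip]
    · exact flipBit_of_ne _ _ (hr 0)
    · have := h 0
      rw [flipBit_self] at this
      simpa using this
    · have hne : t j ≠ t 0 := by
        intro h
        rw [t.injective h] at hj
        simp at hj
      rw [← flipBit_of_ne ∅ y hne]
      exact h j
  | succ i ih =>
    obtain ⟨F, hF, hF'⟩ := ih (Nat.le_of_succ_le hi)
    set a : Fin (L + 1) := ⟨i, by omega⟩ with ha
    set b : Fin (L + 1) := ⟨i + 1, by omega⟩ with hb
    set c : Fin L := ⟨i, hi⟩ with hc
    set g : Bits w → Bits w := fun y => flipBit (t b) {t a} (flipBit (t b) {t a, q c} y) with hg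
    have hg₁ : ∀ y r, r ≠ t b → g y r = y r := fun y r hr => by
      simp only [hg]
      rw [flipBit_of_ne _ _ hr, flipBit_of_ne _ _ hr]
    have hab : t a ≠ t b := by
      intro h
      simpa [ha, hb] using t.injective h
    have hg₂ : ∀ y, g y (t b) = (y (t b) ^^ (y (t a) && !y (q c))) := fun y => by
      simp only [hg]
      rw [flipBit_self, flipBit_self]
      simp only [Finset.mem_singleton, forall_eq, flipBit_of_ne _ _ hab, Finset.mem_insert,
        forall_eq_or_imp]
      cases y (t b) <;> cases y (t a) <;> cases y (q c) <;> rfl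
    refine ⟨F ∘ g, fun ψ y => ?_, fun y => ⟨fun r hr => ?_, fun h => ⟨?_, fun j hj => ?_⟩⟩⟩
    · rw [ladder, run_append, run_cons, run_cons, run_nil]
      simp only [Gate.apply, applyQubit_bitFlip]
      exact hF ψ _
    · rw [Function.comp_apply, (hF' (g y)).1 r hr, hg₁ y r (hr b)]
    · obtain ⟨h₁, h₂⟩ := (hF' (g y)).2 h
      have h₃ := h₂ b (by simp [hb])
      rw [hg₂] at h₃
      rw [hg₁ y _ hab] at h₁
      have h₄ : y (t b) = (y (t a) && !y (q c)) := by
        revert h₃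
        cases y (t b) <;> cases (y (t a) && !y (q c)) <;> simp
      rw [h₄, Bool.and_eq_true, h₁]
      constructor
      · rintro ⟨h₅, h₆⟩ j hj
        rcases Nat.lt_succ_iff_lt_or_eq.mp hj with hj | hj
        · rw [← hg₁ y _ (hqt j b)]
          exact h₅ j hj
        · have : j = c := Fin.ext hj
          simpa [this] using h₆
      · intro h₅
        refine ⟨fun j hj => ?_, ?_⟩
        · rw [hg₁ y _ (hqt j b)]
          exact h₅ j (by omega)
        · simp [h₅ c (by simp [hc])]
    · have hne : t j ≠ t b := by
        intro h
        rw [t.injective h] at hj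
        simp [hb] at hj
      rw [← hg₁ y _ hne]
      exact ((hF' (g y)).2 h).2 j (by omega)

/-- A circuit for the reflection in `|0…0⟩`, given that the qubits `t 0, …, t L` are clean. -/
def reflection : List (Gate n m w) :=
  ladder q t hqt L le_rfl ++
    .elem signFlip (t (Fin.last L)) ∅ (by simp) (by simp) :: invCircuit (ladder q t hqt L le_rfl)

theorem run_reflection (P : Preparers n m) (hall : ∀ r, (∃ i, q i = r) ∨ ∃ j, t j = r)
    {ψ : Bits w → ℂ} (hψ : ∀ x j, x (t j) = true → ψ x = 0) :
    run P (reflection q t hqt) ψ = (2 * ψ fun _ => false) • zeroKet w - ψ := by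
  rw [reflection, run_append, run_cons]
  -- On clean inputs the last flag is 1 only for |0…0⟩, so the sign flip after the ladder equals
  -- 2|0…0⟩⟨0…0| - 1 before it. The inverse ladder then cancels the ladder.
  have key : Gate.apply P (.elem signFlip (t (Fin.last L)) ∅ (by simp) (by simp) : Gate n m w)
      (run P (ladder q t hqt L le_rfl) ψ) =
      run P (ladder q t hqt L le_rfl) ((2 * ψ fun _ => false) • zeroKet w - ψ) := by
    obtain ⟨F, hF, hF'⟩ := exists_run_ladder q t hqt P L le_rfl
    funext y
    simp only [Gate.apply]
    rw [applyQubit_signFlip, hF, hF, Pi.sub_apply, Pi.smul_apply, smul_eq_mul]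
    by_cases hc : ∀ j, F y (t j) = false
    · have hlast := ((hF' y).2 hc).1
      change (y (t (Fin.last L)) = true ↔ _) at hlast
      by_cases hy : y (t (Fin.last L)) = true
      · have h0 : F y = fun _ => false := by
          funext r
          rcases hall r with ⟨i, rfl⟩ | ⟨j, rfl⟩
          · rw [(hF' y).1 _ (hqt i)]
            exact hlast.mp hy i i.2
          · exact hc j
        rw [if_pos hy, h0]
        simp only [zeroKet, Pi.single_eq_same]
        ring
      · have h0 : F y ≠ fun _ => false := by
          intro h0
          refine hy (hlast.mpr fun j _ => ?_)
          rw [← (hF' y).1 _ (hqt j), h0]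
        rw [if_neg hy]
        simp [zeroKet, h0]
    · push Not at hc
      obtain ⟨j, hj⟩ := hc
      have h0 : F y ≠ fun _ => false := by
        intro h0
        simp [h0] at hj
      rw [hψ (F y) j (by simpa using hj)]
      simp [zeroKet, h0]
  rw [key, run_invCircuit_run]

theorem sum_cost_ladder (Tξ TY : ℝ) (i : ℕ) (hi : i ≤ L) :
    ((ladder (n := n) (m := m) q t hqt i hi).map (Gate.cost Tξ TY)).sum = 2 * i + 1 := by
  induction i with
  | zero => simp [ladder, Gate.cost]
  | succ i ih =>
    rw [ladder, List.map_append, List.sum_append, ih]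
    simp [Gate.cost]
    ring

theorem sum_cost_reflection (Tξ TY : ℝ) :
    ((reflection (n := n) (m := m) q t hqt).map (Gate.cost Tξ TY)).sum = 4 * L + 3 := by
  rw [reflection, List.map_append, List.sum_append, List.map_cons, List.sum_cons,
    sum_cost_invCircuit, sum_cost_ladder]
  simp only [Gate.cost]
  ring

end Ladder

/-! ### Qubits that a circuit does not touch -/

/-- Qubit `r` is a target of the gate. -/
def Gate.Targets {n m w : ℕ} (r : Fin w) : Gate n m w → Prop
  | .elem _ q _ _ _ => q = r
  | .char _ _ e _ _ _ => ∃ a, e a = r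
  | .label _ e _ _ _ => ∃ a, e a = r

theorem applyRegister_eq_zero {n w : ℕ} (V : Matrix (Bits n) (Bits n) ℂ) (e : Fin n ↪ Fin w)
    (S : Finset (Fin w)) {r : Fin w} (hr : ∀ a, e a ≠ r) {ψ : Bits w → ℂ}
    (hψ : ∀ x, x r = true → ψ x = 0) {x : Bits w} (hx : x r = true) :
    applyRegister V e S ψ x = 0 := by
  unfold applyRegister
  split_ifs
  · refine Finset.sum_eq_zero fun z _ => ?_
    rw [hψ _ (by rw [extend_apply_of_forall_ne e z x hr, hx]), mul_zero]
  · exact hψ x hx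

theorem Gate.apply_eq_zero {n m w : ℕ} (P : Preparers n m) {g : Gate n m w} {r : Fin w}
    (hg : ¬ g.Targets r) {ψ : Bits w → ℂ} (hψ : ∀ x, x r = true → ψ x = 0) {x : Bits w}
    (hx : x r = true) : g.apply P ψ x = 0 := by
  cases g with
  | elem V q S hS hq =>
    simp only [Gate.apply, applyQubit_eq_applyRegister]
    exact applyRegister_eq_zero _ (singleQubit q) _ (fun _ => hg) hψ hx
  | char j i e S hS he =>
    exact applyRegister_eq_zero _ _ _ (fun a ha => hg ⟨a, ha⟩) hψ hx
  | label i e S hS he =>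
    exact applyRegister_eq_zero _ _ _ (fun a ha => hg ⟨a, ha⟩) hψ hx

/-- A qubit that is never a target stays clean, even if it serves as a control. This supplies the
hypothesis of `run_reflection`. -/
theorem run_eq_zero {n m w : ℕ} (P : Preparers n m) {c : List (Gate n m w)} {r : Fin w}
    (hc : ∀ g ∈ c, ¬ g.Targets r) {ψ : Bits w → ℂ} (hψ : ∀ x, x r = true → ψ x = 0)
    {x : Bits w} (hx : x r = true) : run P c ψ x = 0 := by
  induction c generalizing ψ with
  | nil => exact hψ x hx
  | cons g c ih =>
    rw [run_cons]
    exact ih (fun g' hg' => hc g' (List.mem_cons_of_mem _ hg'))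
      fun x hx => g.apply_eq_zero P (hc g List.mem_cons_self) hψ hx

theorem Gate.targets_inv {n m w : ℕ} (g : Gate n m w) (r : Fin w) :
    g.inv.Targets r ↔ g.Targets r := by
  cases g <;> rfl

theorem not_targets_invCircuit {n m w : ℕ} {c : List (Gate n m w)} {r : Fin w}
    (hc : ∀ g ∈ c, ¬ g.Targets r) : ∀ g ∈ invCircuit c, ¬ g.Targets r := by
  intro g hg
  simp only [invCircuit, List.mem_reverse, List.mem_map] at hg
  obtain ⟨g', hg', rfl⟩ := hg
  rw [Gate.targets_inv]
  exact hc g' hg'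

/-! ### Amplification circuits -/

/-- The observable `Q` on qubit `z`, transported by the circuit `c`. -/
def conjugate {n m w : ℕ} (c : List (Gate n m w)) (Q : Matrix.unitaryGroup Bool ℂ) (z : Fin w) :
    List (Gate n m w) :=
  c ++ .elem Q z ∅ (by simp) (by simp) :: invCircuit c

/-- The `s`-fold repetition of a circuit. -/
def repeatCircuit {n m w : ℕ} (c : List (Gate n m w)) : ℕ → List (Gate n m w)
  | 0 => []
  | s + 1 => c ++ repeatCircuit c s

theorem run_repeatCircuit {n m w : ℕ} (P : Preparers n m) (c : List (Gate n m w)) (s : ℕ)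
    (ψ : Bits w → ℂ) : run P (repeatCircuit c s) ψ = ((run P c : Module.End ℂ _) ^ s) ψ := by
  induction s generalizing ψ with
  | zero => rfl
  | succ s ih => rw [repeatCircuit, run_append, ih, pow_succ, Module.End.mul_apply]

theorem sum_cost_repeatCircuit {n m w : ℕ} (Tξ TY : ℝ) (c : List (Gate n m w)) (s : ℕ) :
    ((repeatCircuit c s).map (Gate.cost Tξ TY)).sum = s * (c.map (Gate.cost Tξ TY)).sum := by
  induction s with
  | zero => simp [repeatCircuit]
  | succ s ih =>
    rw [repeatCircuit, List.map_append, List.sum_append, ih]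
    push_cast
    ring

theorem run_conjugate_conjugate {n m w : ℕ} (P : Preparers n m) (c : List (Gate n m w))
    {Q : Matrix.unitaryGroup Bool ℂ} (hQ : Q * Q = 1) (z : Fin w) (ψ : Bits w → ℂ) :
    run P (conjugate c Q z) (run P (conjugate c Q z) ψ) = ψ := by
  have hinv : ∀ (c : List (Gate n m w)) (φ : Bits w → ℂ),
      run P c (run P (invCircuit c) φ) = φ := by
    intro c φ
    have h : invCircuit (invCircuit c) = c := by
      simp only [invCircuit, List.map_reverse, List.reverse_reverse, List.map_map]
      conv_rhs => rw [← List.map_id c]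
      congr 1
      funext g
      cases g <;> simp [Gate.inv]
    have h' := run_invCircuit_run P (invCircuit c) φ
    rwa [h] at h'
  simp only [conjugate, run_append, run_cons]
  rw [hinv]
  simp only [Gate.apply]
  rw [applyQubit_mul _ _ (by simp)]
  have hQ' : (Q : Matrix Bool Bool ℂ) * Q = 1 := congrArg Subtype.val hQ
  rw [hQ', applyQubit_one, run_invCircuit_run]

theorem run_conjugate_apply_zero {n m w : ℕ} (P : Preparers n m) (c : List (Gate n m w))
    (Q : Matrix.unitaryGroup Bool ℂ) (z : Fin w) :
    run P (conjugate c Q z) (zeroKet w) (fun _ => false) =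
      star (run P c (zeroKet w)) ⬝ᵥ applyQubit Q z ∅ (run P c (zeroKet w)) := by
  rw [dotProduct_run, dotProduct_zeroKet, conjugate, run_append, run_cons]
  rfl

/-- The reflection has to be correct at |0…0⟩ and B|0…0⟩ only, and both have clean work qubits
because neither `c` nor `Q` acts on them. -/
theorem finalState_amplification {n m w L : ℕ} (P : Preparers n m) (q : Fin L → Fin w)
    (t : Fin (L + 1) ↪ Fin w) (hqt : ∀ i j, q i ≠ t j)
    (hall : ∀ r, (∃ i, q i = r) ∨ ∃ j, t j = r) (c : List (Gate n m w))
    (hc : ∀ g ∈ c, ∀ j, ¬ g.Targets (t j)) {Q : Matrix.unitaryGroup Bool ℂ} (hQ : Q * Q = 1)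
    {z : Fin w} (hz : ∀ j, z ≠ t j) {θ : ℝ}
    (hθ : star (run P c (zeroKet w)) ⬝ᵥ applyQubit Q z ∅ (run P c (zeroKet w)) =
      (Real.cos θ : ℂ)) (s : ℕ) :
    finalState P (repeatCircuit (reflection q t hqt ++ conjugate c Q z) s) (fun _ => false) =
      (Real.cos (s * θ) : ℂ) := by
  have hzero : ∀ (x : Bits w) j, x (t j) = true → zeroKet w x = 0 := by
    intro x j hx
    have : x ≠ fun _ => false := by
      rintro rfl
      simp at hx
    simp [zeroKet, this]
  have hB : ∀ (x : Bits w) j, x (t j) = true → run P (conjugate c Q z) (zeroKet w) x = 0 := by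
    intro x j hx
    refine run_eq_zero P ?_ (fun x hx => hzero x j hx) hx
    intro g hg
    simp only [conjugate, List.mem_append, List.mem_cons] at hg
    rcases hg with hg | rfl | hg
    · exact hc g hg j
    · exact hz j
    · exact not_targets_invCircuit (fun g hg => hc g hg j) g hg
  rw [finalState_eq_run, run_repeatCircuit]
  have hmul : (run P (reflection q t hqt ++ conjugate c Q z) : Module.End ℂ (Bits w → ℂ)) =
      (run P (conjugate c Q z) : Module.End ℂ (Bits w → ℂ)) * run P (reflection q t hqt) :=
    LinearMap.ext fun ψ => run_append P _ _ ψ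
  rw [hmul]
  have h := apply_pow_mul_reflection (run P (conjugate c Q z)) (run P (reflection q t hqt))
    (LinearMap.proj (fun _ => false)) (v := zeroKet w) (θ := θ) ?_
    (run_conjugate_conjugate P c hQ z _) ?_ ?_ ?_ s
  · exact h
  · rw [run_reflection q t hqt P hall hzero]
    simp only [zeroKet, Pi.single_eq_same]
    module
  · rw [run_reflection q t hqt P hall hB, run_conjugate_apply_zero, hθ]
  · simp [zeroKet]
  · rw [LinearMap.proj_apply, run_conjugate_apply_zero, hθ]

/-! ### The layout of the qubits

Two index registers of `n` qubits, one control qubit, and `2 n + 2` work qubits. -/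

/-- The first index register. -/
def regA (n : ℕ) : Fin n ↪ Fin (4 * n + 3) :=
  ⟨fun a => ⟨a, by omega⟩, fun a b h => Fin.ext (by simpa using h)⟩

/-- The second index register. -/
def regB (n : ℕ) : Fin n ↪ Fin (4 * n + 3) :=
  ⟨fun a => ⟨n + a, by omega⟩, fun a b h => Fin.ext (by simpa using h)⟩

/-- The control qubit. -/
def ctrl (n : ℕ) : Fin (4 * n + 3) := ⟨2 * n, by omega⟩

/-- The two registers and the control qubit. -/
def dataQubit (n : ℕ) (i : Fin (2 * n + 1)) : Fin (4 * n + 3) := ⟨i, by omega⟩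

/-- The work qubits. -/
def workQubit (n : ℕ) : Fin (2 * n + 1 + 1) ↪ Fin (4 * n + 3) :=
  ⟨fun a => ⟨2 * n + 1 + a, by omega⟩, fun a b h => Fin.ext (by simpa using h)⟩

section Layout

variable {n : ℕ}

theorem regA_val (a : Fin n) : (regA n a).1 = a := rfl

theorem regB_val (a : Fin n) : (regB n a).1 = n + a := rfl

theorem ctrl_val : (ctrl n).1 = 2 * n := rfl

theorem dataQubit_val (i : Fin (2 * n + 1)) : (dataQubit n i).1 = i := rfl

theorem workQubit_val (j : Fin (2 * n + 1 + 1)) : (workQubit n j).1 = 2 * n + 1 + j := rfl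

theorem regA_ne_regB (a b : Fin n) : regA n a ≠ regB n b := by
  rw [ne_eq, Fin.ext_iff, regA_val, regB_val]; omega

theorem regA_ne_ctrl (a : Fin n) : regA n a ≠ ctrl n := by
  rw [ne_eq, Fin.ext_iff, regA_val, ctrl_val]; omega

theorem regB_ne_ctrl (a : Fin n) : regB n a ≠ ctrl n := by
  rw [ne_eq, Fin.ext_iff, regB_val, ctrl_val]; omega

theorem regA_ne_workQubit (a : Fin n) (j : Fin (2 * n + 1 + 1)) : regA n a ≠ workQubit n j := by
  rw [ne_eq, Fin.ext_iff, regA_val, workQubit_val]; omega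

theorem regB_ne_workQubit (a : Fin n) (j : Fin (2 * n + 1 + 1)) : regB n a ≠ workQubit n j := by
  rw [ne_eq, Fin.ext_iff, regB_val, workQubit_val]; omega

theorem ctrl_ne_workQubit (j : Fin (2 * n + 1 + 1)) : ctrl n ≠ workQubit n j := by
  rw [ne_eq, Fin.ext_iff, ctrl_val, workQubit_val]; omega

theorem dataQubit_ne_workQubit (i : Fin (2 * n + 1)) (j : Fin (2 * n + 1 + 1)) :
    dataQubit n i ≠ workQubit n j := by
  rw [ne_eq, Fin.ext_iff, dataQubit_val, workQubit_val]; omega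

theorem exists_dataQubit_or_workQubit (r : Fin (4 * n + 3)) :
    (∃ i, dataQubit n i = r) ∨ ∃ j, workQubit n j = r := by
  by_cases h : r.1 < 2 * n + 1
  · exact Or.inl ⟨⟨r, h⟩, rfl⟩
  · refine Or.inr ⟨⟨r.1 - (2 * n + 1), by omega⟩, Fin.ext ?_⟩
    rw [workQubit_val]
    dsimp only
    omega

theorem exists_reg_or_ctrl_or_workQubit (r : Fin (4 * n + 3)) :
    (∃ a, regA n a = r) ∨ (∃ a, regB n a = r) ∨ ctrl n = r ∨ ∃ j, workQubit n j = r := by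
  rcases exists_dataQubit_or_workQubit r with ⟨i, rfl⟩ | h
  · by_cases h₁ : i.1 < n
    · exact Or.inl ⟨⟨i, h₁⟩, rfl⟩
    by_cases h₂ : i.1 < 2 * n
    · refine Or.inr (Or.inl ⟨⟨i.1 - n, by omega⟩, Fin.ext ?_⟩)
      rw [regB_val, dataQubit_val]
      dsimp only
      omega
    · refine Or.inr (Or.inr (Or.inl (Fin.ext ?_)))
      rw [ctrl_val, dataQubit_val]
      omega
  · exact Or.inr (Or.inr (Or.inr h))

/-- The basis state with given control qubit and registers, and clean work qubits. -/
def assemble (b : Bool) (u v : Bits n) : Bits (4 * n + 3) :=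
  Function.extend (regA n) u
    (Function.extend (regB n) v (Function.update (fun _ => false) (ctrl n) b))

theorem assemble_comp_regA (b : Bool) (u v : Bits n) : assemble b u v ∘ regA n = u :=
  extend_comp_self _ _ _

theorem extend_regA_comp_regB (u : Bits n) (x : Bits (4 * n + 3)) :
    Function.extend (regA n) u x ∘ regB n = x ∘ regB n :=
  funext fun b => extend_apply_of_forall_ne _ _ _ fun a => regA_ne_regB a b

theorem extend_regB_comp_regA (u : Bits n) (x : Bits (4 * n + 3)) :
    Function.extend (regB n) u x ∘ regA n = x ∘ regA n :=
  funext fun b => extend_apply_of_forall_ne _ _ _ fun a => (regA_ne_regB b a).symm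

theorem extend_regA_ctrl (u : Bits n) (x : Bits (4 * n + 3)) :
    Function.extend (regA n) u x (ctrl n) = x (ctrl n) :=
  extend_apply_of_forall_ne _ _ _ regA_ne_ctrl

theorem extend_regB_ctrl (u : Bits n) (x : Bits (4 * n + 3)) :
    Function.extend (regB n) u x (ctrl n) = x (ctrl n) :=
  extend_apply_of_forall_ne _ _ _ regB_ne_ctrl

theorem extend_regA_workQubit (u : Bits n) (x : Bits (4 * n + 3)) (j : Fin (2 * n + 1 + 1)) :
    Function.extend (regA n) u x (workQubit n j) = x (workQubit n j) :=
  extend_apply_of_forall_ne _ _ _ fun a => regA_ne_workQubit a j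

theorem extend_regB_workQubit (u : Bits n) (x : Bits (4 * n + 3)) (j : Fin (2 * n + 1 + 1)) :
    Function.extend (regB n) u x (workQubit n j) = x (workQubit n j) :=
  extend_apply_of_forall_ne _ _ _ fun a => regB_ne_workQubit a j

theorem assemble_comp_regB (b : Bool) (u v : Bits n) : assemble b u v ∘ regB n = v := by
  rw [assemble, extend_regA_comp_regB, extend_comp_self]

theorem assemble_ctrl (b : Bool) (u v : Bits n) : assemble b u v (ctrl n) = b := by
  rw [assemble, extend_regA_ctrl, extend_regB_ctrl, Function.update_self]

theorem assemble_workQubit (b : Bool) (u v : Bits n) (j : Fin (2 * n + 1 + 1)) :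
    assemble b u v (workQubit n j) = false := by
  rw [assemble, extend_regA_workQubit, extend_regB_workQubit,
    Function.update_of_ne (ctrl_ne_workQubit j).symm]

theorem assemble_eq {x : Bits (4 * n + 3)} (hx : ∀ j, x (workQubit n j) = false) :
    assemble (x (ctrl n)) (x ∘ regA n) (x ∘ regB n) = x := by
  funext r
  rcases exists_reg_or_ctrl_or_workQubit r with ⟨a, rfl⟩ | ⟨a, rfl⟩ | rfl | ⟨j, rfl⟩
  · exact congrFun (assemble_comp_regA _ _ _) a
  · exact congrFun (assemble_comp_regB _ _ _) a
  · exact assemble_ctrl _ _ _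
  · rw [assemble_workQubit, hx]

/-- The state with clean work qubits and the given amplitudes on the control qubit and the
registers. -/
def embedState (f : Bool → Bits n → Bits n → ℂ) (x : Bits (4 * n + 3)) : ℂ :=
  if ∀ j, x (workQubit n j) = false then f (x (ctrl n)) (x ∘ regA n) (x ∘ regB n) else 0

theorem dotProduct_embedState (f g : Bool → Bits n → Bits n → ℂ) :
    star (embedState f) ⬝ᵥ embedState g = ∑ b, ∑ u, ∑ v, star (f b u v) * g b u v := by
  have h := Fintype.sum_of_injective
    (fun p : Bool × Bits n × Bits n => assemble p.1 p.2.1 p.2.2) ?_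
    (fun p => star (f p.1 p.2.1 p.2.2) * g p.1 p.2.1 p.2.2)
    (fun x => star (embedState f x) * embedState g x) ?_ ?_
  · rw [Fintype.sum_prod_type] at h
    simp only [Fintype.sum_prod_type] at h
    exact h.symm
  · rintro ⟨b, u, v⟩ ⟨b', u', v'⟩ h
    simp only at h
    rw [Prod.mk.injEq, Prod.mk.injEq]
    refine ⟨?_, ?_, ?_⟩
    · rw [← assemble_ctrl b u v, h, assemble_ctrl]
    · rw [← assemble_comp_regA b u v, h, assemble_comp_regA]
    · rw [← assemble_comp_regB b u v, h, assemble_comp_regB]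
  · intro x hx
    have : ¬ ∀ j, x (workQubit n j) = false := fun h => hx ⟨(_, _, _), assemble_eq h⟩
    simp [embedState, this]
  · rintro ⟨b, u, v⟩
    simp [embedState, assemble_workQubit, assemble_ctrl, assemble_comp_regA, assemble_comp_regB]

theorem zeroKet_eq_embedState : zeroKet (4 * n + 3) =
    embedState fun b u v => (if b then 0 else 1) * (zeroKet n u * zeroKet n v) := by
  have hz : ∀ (w : ℕ) (x : Bits w), zeroKet w x = if x = fun _ => false then 1 else 0 :=
    fun w x => by simp [zeroKet, Pi.single_apply]
  funext x
  by_cases hx : ∀ j, x (workQubit n j) = false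
  · have h : (x = fun _ => false) ↔
        (x (ctrl n) = false ∧ x ∘ regA n = fun _ => false) ∧ x ∘ regB n = fun _ => false := by
      constructor
      · rintro rfl
        exact ⟨⟨rfl, rfl⟩, rfl⟩
      · rintro ⟨⟨h₁, h₂⟩, h₃⟩
        rw [← assemble_eq hx, h₁, h₂, h₃]
        have h₀ := assemble_eq (n := n) (x := fun _ => false) fun _ => rfl
        exact h₀
    rw [embedState, if_pos hx, hz, hz, hz]
    simp only [h]
    by_cases h₁ : x (ctrl n) = false <;> by_cases h₂ : (x ∘ regA n = fun _ => false) <;>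
      by_cases h₃ : (x ∘ regB n = fun _ => false) <;> simp [h₁, h₂, h₃]
  · rw [embedState, if_neg hx, hz, if_neg]
    rintro rfl
    simp at hx

theorem applyQubit_ctrl_embedState (V : Matrix Bool Bool ℂ) (f : Bool → Bits n → Bits n → ℂ) :
    applyQubit V (ctrl n) ∅ (embedState f) =
      embedState fun b u v => ∑ b', V b b' * f b' u v := by
  funext x
  have h₁ : ∀ b j, Function.update x (ctrl n) b (workQubit n j) = x (workQubit n j) :=
    fun b j => Function.update_of_ne (ctrl_ne_workQubit j).symm _ _
  have h₂ : ∀ b, Function.update x (ctrl n) b ∘ regA n = x ∘ regA n :=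
    fun b => funext fun a => Function.update_of_ne (regA_ne_ctrl a) _ _
  have h₃ : ∀ b, Function.update x (ctrl n) b ∘ regB n = x ∘ regB n :=
    fun b => funext fun a => Function.update_of_ne (regB_ne_ctrl a) _ _
  simp only [applyQubit, embedState, h₁, h₂, h₃, Function.update_self]
  rw [if_pos (by simp)]
  split_ifs <;> simp

theorem applyRegister_regA_embedState (V : Matrix (Bits n) (Bits n) ℂ)
    (f : Bool → Bits n → Bits n → ℂ) :
    applyRegister V (regA n) {ctrl n} (embedState f) =
      embedState fun b u v => if b then (V *ᵥ fun u' => f b u' v) u else f b u v := by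
  funext x
  simp only [applyRegister, embedState, extend_regA_workQubit, extend_regA_ctrl,
    extend_regA_comp_regB, extend_comp_self, Finset.mem_singleton, forall_eq, Matrix.mulVec,
    dotProduct]
  split_ifs <;> simp_all

theorem applyRegister_regB_embedState (V : Matrix (Bits n) (Bits n) ℂ)
    (f : Bool → Bits n → Bits n → ℂ) :
    applyRegister V (regB n) {ctrl n} (embedState f) =
      embedState fun b u v => if b then (V *ᵥ fun v' => f b u v') v else f b u v := by
  funext x
  simp only [applyRegister, embedState, extend_regB_workQubit, extend_regB_ctrl,
    extend_regB_comp_regA, extend_comp_self, Finset.mem_singleton, forall_eq, Matrix.mulVec,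
    dotProduct]
  split_ifs <;> simp_all

theorem applyQubit_copy_embedState (a : Fin n) (f : Bool → Bits n → Bits n → ℂ) :
    applyQubit (bitFlip : Matrix Bool Bool ℂ) (regB n a) {regA n a} (embedState f) =
      embedState fun b u v => f b u (Function.update v a (v a ^^ u a)) := by
  funext x
  rw [applyQubit_bitFlip]
  have h₁ : ∀ j, flipBit (regB n a) {regA n a} x (workQubit n j) = x (workQubit n j) :=
    fun j => flipBit_of_ne _ _ (regB_ne_workQubit a j).symm
  have h₂ : flipBit (regB n a) {regA n a} x ∘ regA n = x ∘ regA n :=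
    funext fun b => flipBit_of_ne _ _ (regA_ne_regB b a)
  have h₃ : flipBit (regB n a) {regA n a} x (ctrl n) = x (ctrl n) :=
    flipBit_of_ne _ _ (regB_ne_ctrl a).symm
  have h₄ : flipBit (regB n a) {regA n a} x ∘ regB n =
      Function.update (x ∘ regB n) a ((x ∘ regB n) a ^^ (x ∘ regA n) a) := by
    funext b
    by_cases hb : b = a
    · subst hb
      simp [flipBit_self]
    · rw [Function.update_of_ne hb]
      exact flipBit_of_ne _ _ fun h => hb ((regB n).injective h)
  simp only [embedState, h₁, h₂, h₃, h₄]

/-! ### The preparation circuit -/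

/-- The circuit that adds the first register to the second one. -/
def copyCircuit (m : ℕ) (l : List (Fin n)) : List (Gate n m (4 * n + 3)) :=
  l.map fun a => .elem bitFlip (regB n a) {regA n a} (by simp)
    (by simpa using (regA_ne_regB a a).symm)

/-- A position listed twice would undo its own flip, hence `Nodup`. -/
theorem run_copyCircuit {m : ℕ} (P : Preparers n m) {l : List (Fin n)} (hl : l.Nodup)
    (f : Bool → Bits n → Bits n → ℂ) :
    run P (copyCircuit m l) (embedState f) =
      embedState fun b u v => f b u fun a => v a ^^ (u a && decide (a ∈ l)) := by
  induction l generalizing f with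
  | nil => simp [copyCircuit]
  | cons a l ih =>
    rw [List.nodup_cons] at hl
    rw [copyCircuit, List.map_cons, run_cons]
    simp only [Gate.apply]
    rw [applyQubit_copy_embedState]
    refine (ih hl.2 _).trans ?_
    congr 1
    funext b u v
    congr 1
    funext a'
    by_cases h : a' = a
    · subst h
      simp [hl.1]
    · simp [h]

/-- The rotation of the control qubit. -/
def ctrlRotation : Matrix.unitaryGroup Bool ℂ :=
  ⟨Matrix.of fun a b => if a = b then 12 / 13 else if a then 5 / 13 else -5 / 13, by
    rw [Matrix.mem_unitaryGroup_iff]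
    ext a b
    cases a <;> cases b <;> simp [Matrix.mul_apply, map_ofNat] <;> norm_num⟩

/-- The observable that is measured on the control qubit. -/
def ctrlObservable : Matrix.unitaryGroup Bool ℂ :=
  ⟨Matrix.of fun a b => if a = b then (if a then 24 / 25 else -24 / 25) else 7 / 25, by
    rw [Matrix.mem_unitaryGroup_iff]
    ext a b
    cases a <;> cases b <;> simp [Matrix.mul_apply, map_ofNat] <;> norm_num⟩

theorem ctrlObservable_mul_self : ctrlObservable * ctrlObservable = 1 := by
  ext a b
  cases a <;> cases b <;>
    simp [ctrlObservable, Matrix.mul_apply, Complex.ext_iff] <;> norm_num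

/-- The circuit that prepares, controlled on one qubit, two copies of a characteristic state and
a copied label state. -/
def prepCircuit {m : ℕ} (j : Fin m) : List (Gate n m (4 * n + 3)) :=
  [.elem ctrlRotation (ctrl n) ∅ (by simp) (by simp),
    .label false (regA n) {ctrl n} (by simp) (by simpa using regA_ne_ctrl)] ++
  copyCircuit m (List.finRange n) ++
  [.elem bitFlip (ctrl n) ∅ (by simp) (by simp),
    .char j false (regA n) {ctrl n} (by simp) (by simpa using regA_ne_ctrl),
    .char j false (regB n) {ctrl n} (by simp) (by simpa using regB_ne_ctrl)]

/-- The label state is made in the branch with control 1, of amplitude 5/13. The copy is not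
controlled, but it does nothing in the other branch, where both registers are still zero. Flipping
the control then exposes that branch to the two preparations of ξ. -/
theorem run_prepCircuit {m : ℕ} (P : Preparers n m) (j : Fin m) {ξ y : Bits n → ℂ}
    (hξ : (P.char j : Matrix (Bits n) (Bits n) ℂ) *ᵥ zeroKet n = ξ)
    (hy : (P.label : Matrix (Bits n) (Bits n) ℂ) *ᵥ zeroKet n = y) :
    run P (prepCircuit j) (zeroKet (4 * n + 3)) = embedState fun b u v =>
      if b then 12 / 13 * (ξ u * ξ v) else 5 / 13 * (if u = v then y u else 0) := by
  have hz : ∀ x : Bits n, zeroKet n x = if x = fun _ => false then 1 else 0 :=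
    fun x => by simp [zeroKet, Pi.single_apply]
  have hmul : ∀ (V : Matrix (Bits n) (Bits n) ℂ) (c : ℂ), V *ᵥ (fun u => c * zeroKet n u) =
      c • (V *ᵥ zeroKet n) := fun V c => Matrix.mulVec_smul V c (zeroKet n)
  have hxor : ∀ u v : Bits n, ((fun a => v a ^^ u a) = fun _ => false) ↔ u = v := by
    intro u v
    simp only [funext_iff, bne_eq_false_iff_eq]
    exact forall_congr' fun a => eq_comm
  rw [prepCircuit, run_append, run_append, zeroKet_eq_embedState]
  simp only [run_cons, run_nil, Gate.apply, orInverse, Bool.false_eq_true, if_false]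
  rw [applyQubit_ctrl_embedState, applyRegister_regA_embedState,
    run_copyCircuit P (List.nodup_finRange n), applyQubit_ctrl_embedState,
    applyRegister_regA_embedState, applyRegister_regB_embedState]
  congr 1
  funext b u v
  cases b
  · have h : (fun u' : Bits n => (5 / 13 : ℂ) * (zeroKet n u' * zeroKet n fun a => v a ^^ u a)) =
        fun u' => (5 / 13 * zeroKet n fun a => v a ^^ u a) * zeroKet n u' := by
      funext u'
      ring
    simp [bitFlip, ctrlRotation]
    rw [h, hmul, hy, Pi.smul_apply, hz]
    simp only [hxor, smul_eq_mul]
    split_ifs <;> ring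
  · have h : ∀ v' : Bits n, (fun u' : Bits n => (12 / 13 : ℂ) *
        (zeroKet n u' * zeroKet n fun a => v' a ^^ u' a)) =
        fun u' => (12 / 13 * zeroKet n v') * zeroKet n u' := by
      intro v'
      funext u'
      rw [hz u']
      split_ifs with h
      · simp [h]
      · simp
    simp [bitFlip, ctrlRotation]
    simp only [h, hmul, hξ, Pi.smul_apply, smul_eq_mul]
    have h' : (fun v' => (12 / 13 : ℂ) * zeroKet n v' * ξ u) =
        fun v' => (12 / 13 * ξ u) * zeroKet n v' := by
      funext v'
      ring
    rw [h', hmul, hξ, Pi.smul_apply, smul_eq_mul]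
    ring

theorem not_targets_prepCircuit {m : ℕ} (j : Fin m) :
    ∀ g ∈ prepCircuit (n := n) j, ∀ r, ¬ g.Targets (workQubit n r) := by
  intro g hg r
  simp only [prepCircuit, copyCircuit, List.mem_append, List.mem_cons, List.mem_map,
    List.not_mem_nil, or_false] at hg
  rcases hg with ((rfl | rfl) | ⟨a, -, rfl⟩) | rfl | rfl | rfl
  · exact ctrl_ne_workQubit r
  · exact fun ⟨a, ha⟩ => regA_ne_workQubit a r ha
  · exact regB_ne_workQubit a r
  · exact ctrl_ne_workQubit r
  · exact fun ⟨a, ha⟩ => regA_ne_workQubit a r ha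
  · exact fun ⟨a, ha⟩ => regB_ne_workQubit a r ha

theorem sum_cost_prepCircuit {m : ℕ} (j : Fin m) (Tξ TY : ℝ) :
    ((prepCircuit (n := n) j).map (Gate.cost Tξ TY)).sum = 2 + n + TY + 2 * Tξ := by
  have h : ((copyCircuit m (List.finRange n)).map (Gate.cost Tξ TY)).sum = n := by
    simp [copyCircuit, Function.comp_def, Gate.cost]
  rw [prepCircuit, List.map_append, List.map_append, List.sum_append, List.sum_append, h]
  simp only [List.map_cons, List.map_nil, List.sum_cons, List.sum_nil, Gate.cost]
  ring

/-! ### The expectation of the control observable -/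

theorem dotProduct_mulVec_zeroKet (U : Matrix.unitaryGroup (Bits n) ℂ) {ψ : Bits n → ℂ}
    (h : (U : Matrix (Bits n) (Bits n) ℂ) *ᵥ zeroKet n = ψ) : star ψ ⬝ᵥ ψ = 1 := by
  rw [← h, Matrix.star_mulVec, ← Matrix.dotProduct_mulVec, Matrix.mulVec_mulVec]
  have : (U : Matrix (Bits n) (Bits n) ℂ)ᴴ * (U : Matrix (Bits n) (Bits n) ℂ) = 1 :=
    Matrix.UnitaryGroup.star_mul_self U
  rw [this, Matrix.one_mulVec, dotProduct_zeroKet]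
  simp [zeroKet]

theorem charState_apply_idx {N m : ℕ} (idx : Fin N ↪ Bits n) (leaf : Fin N → Fin m) (j : Fin m)
    (i : Fin N) : charState idx leaf j (idx i) =
      if leaf i = j then ((1 / Real.sqrt ((cluster leaf j).card : ℝ) : ℝ) : ℂ) else 0 := by
  simp only [charState, Finset.sum_apply, Pi.single_apply, EmbeddingLike.apply_eq_iff_eq,
    Finset.sum_ite_eq]
  simp [cluster]

theorem star_charState {N m : ℕ} (idx : Fin N ↪ Bits n) (leaf : Fin N → Fin m) (j : Fin m)
    (u : Bits n) : star (charState idx leaf j u) = charState idx leaf j u := by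
  simp only [charState, Finset.sum_apply, star_sum, Pi.single_apply]
  refine Finset.sum_congr rfl fun i _ => ?_
  split_ifs
  · exact Complex.conj_ofReal _
  · exact star_zero _

theorem star_labelState {N : ℕ} (idx : Fin N ↪ Bits n) (Y : EuclideanSpace ℝ (Fin N))
    (u : Bits n) : star (labelState idx Y u) = labelState idx Y u := by
  simp only [labelState, Finset.sum_apply, star_sum, Pi.single_apply]
  refine Finset.sum_congr rfl fun i _ => ?_
  split_ifs
  · exact Complex.conj_ofReal _
  · exact star_zero _

/-- The square of ξ_j equals 1 / |C_j| on the cluster, so two copies produce the mean with no square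
root of the cluster size. -/
theorem sum_charState_mul_labelState {N m : ℕ} (idx : Fin N ↪ Bits n)
    (Y : EuclideanSpace ℝ (Fin N)) (leaf : Fin N → Fin m) (j : Fin m) :
    ∑ u, charState idx leaf j u * charState idx leaf j u * labelState idx Y u =
      ((meanLabel Y leaf j / ‖Y‖ : ℝ) : ℂ) := by
  have h : ∀ g : Bits n → ℂ, ∑ u, g u * labelState idx Y u =
      ∑ i, g (idx i) * ((Y i / ‖Y‖ : ℝ) : ℂ) := by
    intro g
    simp only [labelState, Finset.sum_apply, Finset.mul_sum]
    rw [Finset.sum_comm]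
    refine Finset.sum_congr rfl fun i _ => ?_
    simp [Pi.single_apply]
  rw [h fun u => charState idx leaf j u * charState idx leaf j u, meanLabel, Finset.sum_div,
    Finset.sum_div, Complex.ofReal_sum, cluster, Finset.sum_filter]
  refine Finset.sum_congr rfl fun i _ => ?_
  rw [charState_apply_idx]
  split_ifs
  · norm_cast
    rw [div_mul_div_comm, Real.mul_self_sqrt (Nat.cast_nonneg _), one_mul, cluster]
    ring
  · simp

/-- The diagonal terms give (24/25)(144 - 25)/169 = 2856/4225, the cross terms 2 ·
(12/13)(5/13)(7/25) = 840/4225 times the overlap. Pythagorean triples keep all entries rational, and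
the bias 2856 keeps the expectation inside (0, 1), away from both ends, for every overlap in [-1,
1]. -/
theorem expectation_prepCircuit {N m : ℕ} {P : Preparers n m} {idx : Fin N ↪ Bits n}
    {Y : EuclideanSpace ℝ (Fin N)} {leaf : Fin N → Fin m} (hP : P.Prepare idx Y leaf)
    (j : Fin m) :
    star (run P (prepCircuit j) (zeroKet (4 * n + 3))) ⬝ᵥ
      applyQubit ctrlObservable (ctrl n) ∅ (run P (prepCircuit j) (zeroKet (4 * n + 3))) =
      (((2856 + 840 * (meanLabel Y leaf j / ‖Y‖)) / 4225 : ℝ) : ℂ) := by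
  have hξ := hP.1 j
  have hy := hP.2
  have nξ := dotProduct_mulVec_zeroKet _ hξ
  have ny := dotProduct_mulVec_zeroKet _ hy
  have cross := sum_charState_mul_labelState idx Y leaf j
  rw [run_prepCircuit P j hξ hy, applyQubit_ctrl_embedState, dotProduct_embedState]
  simp only [dotProduct, Pi.star_apply, star_charState, star_labelState] at nξ ny
  set ξ := charState idx leaf j
  set y := labelState idx Y
  have sξ : ∀ u, star (ξ u) = ξ u := star_charState idx leaf j
  have sy : ∀ u, star (y u) = y u := star_labelState idx Y
  have h₁ : ∑ u, ∑ v, (ξ u * ξ v) * (ξ u * ξ v) = 1 := by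
    have := congrArg₂ (· * ·) nξ nξ
    simp only [Finset.sum_mul_sum, mul_one] at this
    rw [← this]
    refine Finset.sum_congr rfl fun u _ => Finset.sum_congr rfl fun v _ => ?_
    ring
  have h₂ : ∑ u, ∑ v, (if u = v then y u else 0) * (if u = v then y u else 0) = 1 := by
    simpa using ny
  have h₃ : ∑ u, ∑ v, (ξ u * ξ v) * (if u = v then y u else 0) =
      ((meanLabel Y leaf j / ‖Y‖ : ℝ) : ℂ) := by
    rw [← cross]
    refine Finset.sum_congr rfl fun u _ => ?_
    simp
  have s₁ : star (12 / 13 : ℂ) = 12 / 13 := by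
    simp
  have s₂ : star (5 / 13 : ℂ) = 5 / 13 := by
    simp
  have hsum : ∑ b : Bool, ∑ u, ∑ v,
      star (if b = true then 12 / 13 * (ξ u * ξ v) else 5 / 13 * (if u = v then y u else 0)) *
        ∑ b' : Bool, (ctrlObservable : Matrix Bool Bool ℂ) b b' *
          (if b' = true then 12 / 13 * (ξ u * ξ v) else 5 / 13 * (if u = v then y u else 0)) =
      (144 / 169 * (24 / 25)) * ∑ u, ∑ v, (ξ u * ξ v) * (ξ u * ξ v) +
        (25 / 169 * (-24 / 25)) *
          ∑ u, ∑ v, (if u = v then y u else 0) * (if u = v then y u else 0) +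
        (120 / 169 * (7 / 25)) * ∑ u, ∑ v, (ξ u * ξ v) * (if u = v then y u else 0) := by
    rw [Fintype.sum_bool]
    simp only [Finset.mul_sum, ← Finset.sum_add_distrib]
    refine Finset.sum_congr rfl fun u _ => Finset.sum_congr rfl fun v _ => ?_
    have sd : star (if u = v then y u else 0) = if u = v then y u else 0 := by
      split_ifs
      · exact sy u
      · exact star_zero _
    simp only [Fintype.sum_bool, if_true, Bool.false_eq_true, if_false, star_mul', sξ, sd, s₁, s₂]
    simp only [ctrlObservable, Matrix.of_apply, if_true, Bool.false_eq_true, Bool.true_eq_false,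
      if_false]
    split_ifs <;> ring
  rw [hsum, h₁, h₂, h₃]
  push_cast
  ring

end Layout

/-! ### Deviations of independent trials -/

section Deviation

variable {ι Ω : Type*} [Fintype ι] [DecidableEq ι] [Fintype Ω]

open Classical in
/-- The probability of an event for independent trials with the given distributions. -/
def productProb (p : ι → Ω → ℝ) (E : (ι → Ω) → Prop) : ℝ :=
  ∑ x, if E x then ∏ i, p i (x i) else 0

theorem sum_prod_eq_prod_sum (f : ι → Ω → ℝ) : ∑ x : ι → Ω, ∏ i, f i (x i) = ∏ i, ∑ ω, f i ω := by
  rw [Finset.prod_univ_sum, Fintype.piFinset_univ]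

theorem productProb_mono {p : ι → Ω → ℝ} (hp : ∀ i ω, 0 ≤ p i ω) {E F : (ι → Ω) → Prop}
    (h : ∀ x, E x → F x) : productProb p E ≤ productProb p F := by
  refine Finset.sum_le_sum fun x _ => ?_
  have := Finset.prod_nonneg fun i (_ : i ∈ Finset.univ) => hp i (x i)
  by_cases hE : E x
  · rw [if_pos hE, if_pos (h x hE)]
  · rw [if_neg hE]
    split_ifs
    exacts [this, le_rfl]

theorem productProb_not {p : ι → Ω → ℝ} (hp' : ∀ i, ∑ ω, p i ω = 1) (E : (ι → Ω) → Prop) :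
    productProb p (fun x => ¬ E x) = 1 - productProb p E := by
  rw [eq_sub_iff_add_eq, productProb, productProb, ← Finset.sum_add_distrib]
  have h := sum_prod_eq_prod_sum p
  rw [Finset.prod_eq_one fun i _ => hp' i] at h
  rw [← h]
  refine Finset.sum_congr rfl fun x _ => ?_
  by_cases hE : E x <;> simp [hE]

theorem productProb_exists_le {p : ι → Ω → ℝ} (hp : ∀ i ω, 0 ≤ p i ω) {α : Type*} [Fintype α]
    (E : α → (ι → Ω) → Prop) :
    productProb p (fun x => ∃ a, E a x) ≤ ∑ a, productProb p (E a) := by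
  classical
  simp only [productProb]
  rw [Finset.sum_comm]
  refine Finset.sum_le_sum fun x _ => ?_
  have h0 := Finset.prod_nonneg fun i (_ : i ∈ Finset.univ) => hp i (x i)
  have h0' : ∀ a ∈ Finset.univ, 0 ≤ if E a x then ∏ i, p i (x i) else 0 := by
    intro a _
    split_ifs
    exacts [h0, le_rfl]
  split_ifs with h
  · obtain ⟨a, ha⟩ := h
    refine le_trans ?_ (Finset.single_le_sum h0' (Finset.mem_univ a))
    rw [if_pos ha]
  · exact Finset.sum_nonneg h0'

/-- For |u| ≤ 1 one has exp u ≤ 1 + u + u², and the linear term has mean zero. -/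
theorem sum_mul_exp_le {p f : Ω → ℝ} (hp : ∀ ω, 0 ≤ p ω) (hp' : ∑ ω, p ω = 1)
    (hf : ∀ ω, |f ω| ≤ 1) (hf' : ∑ ω, p ω * f ω = 0) {s : ℝ} (hs : |s| ≤ 1) :
    ∑ ω, p ω * Real.exp (s * f ω) ≤ Real.exp (s ^ 2) := by
  have h : ∀ ω, Real.exp (s * f ω) ≤ 1 + s * f ω + s ^ 2 := by
    intro ω
    have h₁ : |s * f ω| ≤ 1 := by
      rw [abs_mul]
      exact mul_le_one₀ hs (abs_nonneg _) (hf ω)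
    have h₂ := (abs_le.mp (Real.abs_exp_sub_one_sub_id_le h₁)).2
    have h₃ : (s * f ω) ^ 2 ≤ s ^ 2 := by
      rw [mul_pow]
      exact mul_le_of_le_one_right (sq_nonneg s) ((sq_le_one_iff_abs_le_one _).mpr (hf ω))
    linarith
  calc ∑ ω, p ω * Real.exp (s * f ω)
      ≤ ∑ ω, p ω * (1 + s * f ω + s ^ 2) :=
        Finset.sum_le_sum fun ω _ => mul_le_mul_of_nonneg_left (h ω) (hp ω)
    _ = (1 + s ^ 2) * ∑ ω, p ω + s * ∑ ω, p ω * f ω := by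
        rw [Finset.mul_sum, Finset.mul_sum, ← Finset.sum_add_distrib]
        exact Finset.sum_congr rfl fun ω _ => by ring
    _ = s ^ 2 + 1 := by
        rw [hp', hf']
        ring
    _ ≤ Real.exp (s ^ 2) := Real.add_one_le_exp _

/-- Chernoff's method: Markov's inequality for the exponential of δ/2 times the sum. The threshold
contributes -δ²/2 per trial and the moment bound +δ²/4. -/
theorem productProb_le_sum_le {p : ι → Ω → ℝ} (hp : ∀ i ω, 0 ≤ p i ω)
    (hp' : ∀ i, ∑ ω, p i ω = 1) (I : Finset ι) {f : ι → Ω → ℝ} (hf : ∀ i ∈ I, ∀ ω, |f i ω| ≤ 1)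
    (hf' : ∀ i ∈ I, ∑ ω, p i ω * f i ω = 0) {δ : ℝ} (hδ : |δ| ≤ 1) (hδ' : 0 ≤ δ) :
    productProb p (fun x => δ * I.card ≤ ∑ i ∈ I, f i (x i)) ≤
      Real.exp (-(δ ^ 2 / 4 * I.card)) := by
  have hs : |δ / 2| ≤ 1 := by
    rw [abs_div, abs_two]
    linarith
  have hexp : ∀ x : ι → Ω, Real.exp (δ / 2 * ∑ i ∈ I, f i (x i)) =
      ∏ i, if i ∈ I then Real.exp (δ / 2 * f i (x i)) else 1 := by
    intro x
    rw [Finset.mul_sum, Real.exp_sum, Finset.prod_ite_mem, Finset.univ_inter]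
  calc productProb p (fun x => δ * I.card ≤ ∑ i ∈ I, f i (x i))
      ≤ ∑ x : ι → Ω, Real.exp (-(δ ^ 2 / 2 * I.card)) *
          ∏ i, (p i (x i) * if i ∈ I then Real.exp (δ / 2 * f i (x i)) else 1) := by
        refine Finset.sum_le_sum fun x _ => ?_
        have h0 := Finset.prod_nonneg fun i (_ : i ∈ Finset.univ) => hp i (x i)
        rw [Finset.prod_mul_distrib, ← hexp, mul_left_comm, ← Real.exp_add]
        split_ifs with h
        · refine le_mul_of_one_le_right h0 (Real.one_le_exp ?_)
          nlinarith
        · positivity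
    _ = Real.exp (-(δ ^ 2 / 2 * I.card)) *
          ∏ i, ∑ ω, (p i ω * if i ∈ I then Real.exp (δ / 2 * f i ω) else 1) := by
        rw [← Finset.mul_sum, sum_prod_eq_prod_sum
          fun i ω => p i ω * if i ∈ I then Real.exp (δ / 2 * f i ω) else 1]
    _ ≤ Real.exp (-(δ ^ 2 / 2 * I.card)) *
          ∏ i, if i ∈ I then Real.exp ((δ / 2) ^ 2) else 1 := by
        refine mul_le_mul_of_nonneg_left (Finset.prod_le_prod (fun i _ => ?_) fun i _ => ?_)
          (Real.exp_nonneg _)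
        · refine Finset.sum_nonneg fun ω _ => mul_nonneg (hp i ω) ?_
          split_ifs <;> positivity
        · by_cases hi : i ∈ I
          · simp only [if_pos hi]
            exact sum_mul_exp_le (hp i) (hp' i) (hf i hi) (hf' i hi) hs
          · simp only [if_neg hi, mul_one]
            exact (hp' i).le
    _ = Real.exp (-(δ ^ 2 / 4 * I.card)) := by
        rw [Finset.prod_ite_mem, Finset.univ_inter, Finset.prod_const, ← Real.exp_nat_mul,
          ← Real.exp_add]
        congr 1
        ring

open Classical in
/-- The number of trials in `I` with outcome `o`. -/
def outcomeCount (I : Finset ι) (o : Ω) (x : ι → Ω) : ℝ :=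
  ∑ i ∈ I, if x i = o then 1 else 0

theorem productProb_lt_abs_outcomeCount_sub_le {p : ι → Ω → ℝ} (hp : ∀ i ω, 0 ≤ p i ω)
    (hp' : ∀ i, ∑ ω, p i ω = 1) (I : Finset ι) (o : Ω) {μ : ℝ} (hμ : ∀ i ∈ I, p i o = μ)
    {δ : ℝ} (hδ : |δ| ≤ 1) (hδ' : 0 ≤ δ) :
    productProb p (fun x => δ * I.card < |outcomeCount I o x - I.card * μ|) ≤
      2 * Real.exp (-(δ ^ 2 / 4 * I.card)) := by
  classical
  have hb : ∀ i ∈ I, 0 ≤ μ ∧ μ ≤ 1 := by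
    intro i hi
    rw [← hμ i hi]
    refine ⟨hp i o, ?_⟩
    rw [← hp' i]
    exact Finset.single_le_sum (fun ω _ => hp i ω) (Finset.mem_univ o)
  have habs : ∀ i ∈ I, ∀ ω, |(if ω = o then 1 else 0) - μ| ≤ 1 := by
    intro i hi ω
    obtain ⟨h₁, h₂⟩ := hb i hi
    split_ifs <;> rw [abs_le] <;> constructor <;> linarith
  have hmean : ∀ i ∈ I, ∑ ω, p i ω * ((if ω = o then 1 else 0) - μ) = 0 := by
    intro i hi
    simp only [mul_sub, Finset.sum_sub_distrib, ← Finset.sum_mul, hp' i, one_mul]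
    simp [hμ i hi]
  have hsum : ∀ x : ι → Ω, ∑ i ∈ I, ((if x i = o then (1 : ℝ) else 0) - μ) =
      outcomeCount I o x - I.card * μ := by
    intro x
    rw [Finset.sum_sub_distrib, Finset.sum_const, nsmul_eq_mul, outcomeCount]
  have h₁ := productProb_le_sum_le hp hp' I (f := fun _ ω => (if ω = o then 1 else 0) - μ)
    habs hmean hδ hδ'
  have h₂ := productProb_le_sum_le hp hp' I (f := fun _ ω => -((if ω = o then 1 else 0) - μ))
    (fun i hi ω => by rw [abs_neg]; exact habs i hi ω)
    (fun i hi => by simpa only [mul_neg, Finset.sum_neg_distrib, neg_eq_zero] using hmean i hi)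
    hδ hδ'
  simp only [Finset.sum_neg_distrib, hsum] at h₁ h₂
  set E : Bool → (ι → Ω) → Prop := fun b x => if b then
    δ * I.card ≤ outcomeCount I o x - I.card * μ else
    δ * I.card ≤ -(outcomeCount I o x - I.card * μ) with hE
  calc productProb p (fun x => δ * I.card < |outcomeCount I o x - I.card * μ|)
      ≤ productProb p (fun x => ∃ b, E b x) := by
        refine productProb_mono hp fun x hx => ?_
        rcases lt_abs.mp hx with h | h
        · exact ⟨true, h.le⟩
        · exact ⟨false, h.le⟩
    _ ≤ ∑ b, productProb p (E b) := productProb_exists_le hp E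
    _ ≤ 2 * Real.exp (-(δ ^ 2 / 4 * I.card)) := by
        rw [Fintype.sum_bool]
        simp only [hE, if_true, Bool.false_eq_true, if_false]
        linarith

end Deviation

/-! ### Angles from the cosines of their multiples -/

theorem abs_le_of_abs_sin_le {u τ : ℝ} (hu : |u| ≤ Real.pi / 2) (h : |Real.sin u| ≤ τ) :
    |u| ≤ Real.pi / 2 * τ := by
  have h₁ := Real.mul_abs_le_abs_sin hu
  have hπ := Real.pi_pos
  have h₂ : 2 / Real.pi * |u| ≤ τ := h₁.trans h
  calc |u| = Real.pi / 2 * (2 / Real.pi * |u|) := by field_simp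
    _ ≤ Real.pi / 2 * τ := by gcongr

theorem abs_cos_sub_cos (x y : ℝ) :
    |Real.cos x - Real.cos y| = 2 * |Real.sin ((x + y) / 2)| * |Real.sin ((x - y) / 2)| := by
  rw [Real.cos_sub_cos, abs_mul, abs_mul, abs_neg, abs_two]

theorem abs_sin_half_sub_le {s φ φ' : ℝ}
    (h : |Real.cos (s * φ) - Real.cos (s * φ')| ≤ 1 / 5)
    (hs : 3 / 10 ≤ |Real.sin (s * ((φ + φ') / 2))|) :
    |Real.sin (s * ((φ - φ') / 2))| ≤ 1 / 3 := by
  rw [abs_cos_sub_cos, ← mul_add, ← mul_sub, mul_div_assoc, mul_div_assoc] at h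
  nlinarith [abs_nonneg (Real.sin (s * ((φ - φ') / 2)))]

/-- Since σ = (s+1)σ - sσ, the sines of two consecutive multiples cannot both be small unless sin σ
is. This is why both 2^k and 2^k + 1 rounds are used. -/
theorem abs_sin_le_add (s σ : ℝ) :
    |Real.sin σ| ≤ |Real.sin (s * σ)| + |Real.sin ((s + 1) * σ)| := by
  have h : Real.sin σ = Real.sin ((s + 1) * σ) * Real.cos (s * σ) -
      Real.cos ((s + 1) * σ) * Real.sin (s * σ) := by
    rw [← Real.sin_sub]
    congr 1
    ring
  have h₁ : |Real.sin ((s + 1) * σ) * Real.cos (s * σ)| ≤ |Real.sin ((s + 1) * σ)| := by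
    rw [abs_mul]
    exact mul_le_of_le_one_right (abs_nonneg _) (Real.abs_cos_le_one _)
  have h₂ : |Real.cos ((s + 1) * σ) * Real.sin (s * σ)| ≤ |Real.sin (s * σ)| := by
    rw [abs_mul]
    exact mul_le_of_le_one_left (abs_nonneg _) (Real.abs_cos_le_one _)
  rw [h]
  exact (abs_sub _ _).trans (by linarith)

/-- With σ and d the half sum and half difference, the cosines differ by 2 |sin sσ| |sin sd|.
Concavity of the sine gives |sin σ| ≥ 3/5, so at each scale one of the two values of s has |sin sσ|
≥ 3/10 and forces |sin sd| ≤ 1/3. -/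
theorem abs_sub_le_of_abs_cos_sub_cos_le {φ φ' : ℝ} (hφ : φ ∈ Set.Icc 0 Real.pi)
    (hφ' : φ' ∈ Set.Icc 0 Real.pi) (hs : 3 / 5 ≤ Real.sin φ) (hs' : 3 / 5 ≤ Real.sin φ') {K : ℕ}
    (h : ∀ k ≤ K, ∀ β : Bool, |Real.cos ((2 ^ k + β.toNat : ℕ) * φ) -
      Real.cos ((2 ^ k + β.toNat : ℕ) * φ')| ≤ 1 / 5) :
    |φ - φ'| ≤ Real.pi / (3 * 2 ^ K) := by
  have hσ : 3 / 5 ≤ |Real.sin ((φ + φ') / 2)| := by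
    have half : (0 : ℝ) ≤ 1 / 2 := by norm_num
    have hc := strictConcaveOn_sin_Icc.concaveOn.2 hφ hφ' half half (by norm_num)
    simp only [smul_eq_mul] at hc
    have e : (φ + φ') / 2 = 1 / 2 * φ + 1 / 2 * φ' := by ring
    rw [e]
    exact le_trans (by linarith) (le_abs_self _)
  have hπ := Real.pi_pos
  have hd : |(φ - φ') / 2| ≤ Real.pi / 2 := by
    rw [abs_le]
    constructor <;> linarith [hφ.1, hφ.2, hφ'.1, hφ'.2]
  have key : ∀ k ≤ K, 2 ^ k * |(φ - φ') / 2| ≤ Real.pi / 6 := by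
    intro k
    induction k with
    | zero =>
      intro hk
      have h₀ := h 0 hk false
      have h₁ : |Real.sin (1 * ((φ - φ') / 2))| ≤ 1 / 3 := by
        refine abs_sin_half_sub_le (s := 1) (by simpa using h₀) ?_
        rw [one_mul]
        linarith
      rw [one_mul] at h₁
      have := abs_le_of_abs_sin_le hd h₁
      rw [pow_zero, one_mul]
      linarith
    | succ k ih =>
      intro hk
      have ih := ih (by omega)
      have hd0 := abs_nonneg ((φ - φ') / 2)
      have h1k : (1 : ℝ) ≤ 2 ^ k := one_le_pow₀ (by norm_num)
      have hbound : ∀ β : Bool, 3 / 10 ≤ |Real.sin ((2 ^ (k + 1) + β.toNat : ℕ) *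
          ((φ + φ') / 2))| → 2 ^ (k + 1) * |(φ - φ') / 2| ≤ Real.pi / 6 := by
        intro β hβ
        have h₁ := abs_sin_half_sub_le (h (k + 1) hk β) hβ
        have hb : ((β.toNat : ℕ) : ℝ) ≤ 1 := by exact_mod_cast Bool.toNat_le β
        have hb0 : (0 : ℝ) ≤ ((β.toNat : ℕ) : ℝ) := Nat.cast_nonneg _
        have hm : |((2 ^ (k + 1) + β.toNat : ℕ) : ℝ) * ((φ - φ') / 2)| =
            (2 ^ (k + 1) + (β.toNat : ℝ)) * |(φ - φ') / 2| := by
          rw [abs_mul, Nat.abs_cast]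
          push_cast
          rfl
        -- No aliasing: 2^(k+1) + β ≤ 3 · 2^k, so the bound π/6 of the previous scale puts s|d|
        -- within π/2, where |sin sd| ≤ 1/3 gives s|d| ≤ π/6 again.
        have h₂ := abs_le_of_abs_sin_le (by
          rw [hm, pow_succ]
          nlinarith) h₁
        rw [hm] at h₂
        nlinarith
      have hsum := abs_sin_le_add (2 ^ (k + 1)) ((φ + φ') / 2)
      by_cases hβ : 3 / 10 ≤ |Real.sin (2 ^ (k + 1) * ((φ + φ') / 2))|
      · exact hbound false (by simpa using hβ)
      · refine hbound true ?_
        push Not at hβ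
        have : 3 / 10 ≤ |Real.sin ((2 ^ (k + 1) + 1) * ((φ + φ') / 2))| := by linarith
        simpa using this
  have hK := key K le_rfl
  rw [abs_div, abs_two] at hK
  rw [le_div_iff₀ (by positivity)]
  linarith

/-- The angle that encodes the number `a ∈ [-1, 1]` in the amplification circuit. -/
def codeAngle (a : ℝ) : ℝ := Real.arccos ((2856 + 840 * a) / 4225)

theorem cos_codeAngle {a : ℝ} (ha : |a| ≤ 1) :
    Real.cos (codeAngle a) = (2856 + 840 * a) / 4225 := by
  obtain ⟨h₁, h₂⟩ := abs_le.mp ha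
  exact Real.cos_arccos (by linarith) (by linarith)

theorem two_mul_codeAngle_mem {a : ℝ} (ha : |a| ≤ 1) : 2 * codeAngle a ∈ Set.Icc 0 Real.pi := by
  obtain ⟨h₁, h₂⟩ := abs_le.mp ha
  have h₃ : codeAngle a ≤ Real.pi / 2 := Real.arccos_le_pi_div_two.mpr (by linarith)
  have h₄ : 0 ≤ codeAngle a := Real.arccos_nonneg _
  constructor <;> linarith

/-- The encoded cosine b lies between 2/5 and 9/10, so |2b² - 1| ≤ 4/5. -/
theorem le_sin_two_mul_codeAngle {a : ℝ} (ha : |a| ≤ 1) :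
    3 / 5 ≤ Real.sin (2 * codeAngle a) := by
  have hmem := two_mul_codeAngle_mem ha
  have h0 := Real.sin_nonneg_of_mem_Icc hmem
  have hsq := Real.sin_sq_add_cos_sq (2 * codeAngle a)
  rw [Real.cos_two_mul, cos_codeAngle ha] at hsq
  obtain ⟨h₁, h₂⟩ := abs_le.mp ha
  set b : ℝ := (2856 + 840 * a) / 4225 with hb
  have hb₁ : 4 / 10 ≤ b := by rw [hb]; linarith
  have hb₂ : b ≤ 9 / 10 := by rw [hb]; linarith
  have hb₃ : 2 * b ^ 2 - 1 ≤ 4 / 5 := by nlinarith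
  have hb₄ : -(4 / 5) ≤ 2 * b ^ 2 - 1 := by nlinarith
  nlinarith

/-- Doubling the angle turns squared cosines into cosines and the tolerance 1/10 into 1/5. As the
cosine is 1-Lipschitz, the angle error π / (6 · 2^K) costs a factor 4225/840, and 4225 π / (840 · 6)
< 3. -/
theorem abs_sub_le_of_abs_cos_sq_sub_le {a a' : ℝ} (ha : |a| ≤ 1) (ha' : |a'| ≤ 1) {K : ℕ}
    (h : ∀ k ≤ K, ∀ β : Bool, |Real.cos ((2 ^ k + β.toNat : ℕ) * codeAngle a) ^ 2 -
      Real.cos ((2 ^ k + β.toNat : ℕ) * codeAngle a') ^ 2| ≤ 1 / 10) :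
    |a - a'| ≤ 3 / 2 ^ K := by
  have h₁ := abs_sub_le_of_abs_cos_sub_cos_le (two_mul_codeAngle_mem ha)
    (two_mul_codeAngle_mem ha') (le_sin_two_mul_codeAngle ha) (le_sin_two_mul_codeAngle ha')
    (K := K) fun k hk β => by
      have := h k hk β
      rw [mul_left_comm, mul_left_comm _ 2, Real.cos_two_mul, Real.cos_two_mul]
      rw [abs_le] at this ⊢
      constructor <;> linarith [this.1, this.2]
  have h₂ := Real.abs_cos_sub_cos_le (codeAngle a) (codeAngle a')
  rw [cos_codeAngle ha, cos_codeAngle ha'] at h₂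
  rw [← mul_sub, abs_mul, abs_two] at h₁
  have h₃ : |(2856 + 840 * a) / 4225 - (2856 + 840 * a') / 4225| = 840 / 4225 * |a - a'| := by
    have e : (2856 + 840 * a) / 4225 - (2856 + 840 * a') / 4225 = 840 / 4225 * (a - a') := by ring
    rw [e, abs_mul, abs_of_nonneg (by norm_num)]
  rw [h₃] at h₂
  have h₄ : 2 * |codeAngle a - codeAngle a'| * (3 * 2 ^ K) ≤ Real.pi :=
    (le_div_iff₀ (by positivity)).mp h₁
  rw [le_div_iff₀ (by positivity)]
  have h₅ : 840 / 4225 * |a - a'| * 2 ^ K ≤ |codeAngle a - codeAngle a'| * 2 ^ K := by gcongr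
  linarith [Real.pi_lt_d2]

/-! ### The estimation algorithm -/

theorem abs_meanLabel_le {N m : ℕ} (Y : EuclideanSpace ℝ (Fin N)) (leaf : Fin N → Fin m)
    (j : Fin m) : |meanLabel Y leaf j| ≤ ‖Y‖ := by
  rw [meanLabel, abs_div, Nat.abs_cast]
  refine div_le_of_le_mul₀ (Nat.cast_nonneg _) (norm_nonneg _) ?_
  refine (Finset.abs_sum_le_sum_abs _ _).trans ?_
  rw [mul_comm, ← nsmul_eq_mul]
  exact Finset.sum_le_card_nsmul _ _ _ fun i _ => PiLp.norm_apply_le Y i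

/-- The amplification circuit of leaf `j` with `s` rounds. -/
def amplifyCircuit (n : ℕ) {m : ℕ} (j : Fin m) (s : ℕ) : List (Gate n m (4 * n + 3)) :=
  repeatCircuit (reflection (dataQubit n) (workQubit n) dataQubit_ne_workQubit ++
    conjugate (prepCircuit j) ctrlObservable (ctrl n)) s

theorem norm_sq_finalState_amplifyCircuit {N n m : ℕ} {P : Preparers n m} {idx : Fin N ↪ Bits n}
    {Y : EuclideanSpace ℝ (Fin N)} {leaf : Fin N → Fin m} (hP : P.Prepare idx Y leaf) (j : Fin m)
    (ha : |meanLabel Y leaf j / ‖Y‖| ≤ 1) (s : ℕ) :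
    ‖finalState P (amplifyCircuit n j s) (fun _ => false)‖ ^ 2 =
      Real.cos (s * codeAngle (meanLabel Y leaf j / ‖Y‖)) ^ 2 := by
  rw [amplifyCircuit, finalState_amplification P (dataQubit n) (workQubit n)
    dataQubit_ne_workQubit exists_dataQubit_or_workQubit (prepCircuit j)
    (not_targets_prepCircuit j) ctrlObservable_mul_self ctrl_ne_workQubit
    (by rw [expectation_prepCircuit hP, cos_codeAngle ha]), Complex.norm_real, Real.norm_eq_abs,
    sq_abs]

theorem sum_cost_amplifyCircuit (n : ℕ) {m : ℕ} (j : Fin m) (s : ℕ) (Tξ TY : ℝ) :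
    ((amplifyCircuit n j s).map (Gate.cost Tξ TY)).sum =
      s * (10 * n + 12 + 2 * TY + 4 * Tξ) := by
  rw [amplifyCircuit, sum_cost_repeatCircuit, List.map_append, List.sum_append,
    sum_cost_reflection, conjugate, List.map_append, List.sum_append, List.map_cons,
    List.sum_cons, sum_cost_invCircuit, sum_cost_prepCircuit]
  simp only [Gate.cost]
  push_cast
  ring

/-- The number of runs at scale `k`. -/
def repetitions (K L k : ℕ) : ℕ := 6400 * (L + (K - k))

/-- The runs: a leaf, a scale, a shift, and the number of the repetition. -/
abbrev RunIndex (m K L : ℕ) : Type :=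
  Fin m × Σ p : Fin (K + 1) × Bool, Fin (repetitions K L p.1)

/-- The number of rounds of a run. -/
def rounds {K : ℕ} (p : Fin (K + 1) × Bool) : ℕ := 2 ^ p.1.1 + p.2.toNat

/-- The runs for a given leaf, scale and shift. -/
def trials {m : ℕ} (K L : ℕ) (j : Fin m) (p : Fin (K + 1) × Bool) :
    Finset (Fin (Fintype.card (RunIndex m K L))) :=
  Finset.univ.map ⟨fun i => Fintype.equivFin (RunIndex m K L) (j, ⟨p, i⟩), fun i i' h => by
    simpa using h⟩

theorem card_trials {m : ℕ} (K L : ℕ) (j : Fin m) (p : Fin (K + 1) × Bool) :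
    (trials K L j p).card = repetitions K L p.1 := by
  simp [trials]

/-- The number `a` fits the measured frequencies for leaf `j`. -/
def Consistent {n m : ℕ} (K L : ℕ) (j : Fin m)
    (x : Fin (Fintype.card (RunIndex m K L)) → Bits (4 * n + 3)) (a : ℝ) : Prop :=
  |a| ≤ 1 ∧ ∀ p, |outcomeCount (trials K L j p) (fun _ => false) x -
    (trials K L j p).card * Real.cos (rounds p * codeAngle a) ^ 2| ≤
      1 / 20 * (trials K L j p).card

open Classical in
/-- The algorithm that amplifies with all numbers `2 ^ k` and `2 ^ k + 1` of rounds, `k ≤ K`, and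
outputs any value that fits the measured frequencies. -/
def estimator (n m K L : ℕ) (η : ℝ) : Algorithm n m where
  runs := Fintype.card (RunIndex m K L)
  width _ := 4 * n + 3
  circuit r := amplifyCircuit n ((Fintype.equivFin (RunIndex m K L)).symm r).1
    (rounds ((Fintype.equivFin (RunIndex m K L)).symm r).2.1)
  post x j := if h : ∃ a, Consistent K L j x a then η * h.choose else 0

theorem Consistent.abs_sub_le {n m K L : ℕ} (hL : 1 ≤ L) {j : Fin m}
    {x : Fin (Fintype.card (RunIndex m K L)) → Bits (4 * n + 3)} {a a' : ℝ}
    (h : Consistent K L j x a) (h' : Consistent K L j x a') : |a - a'| ≤ 3 / 2 ^ K := by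
  refine abs_sub_le_of_abs_cos_sq_sub_le h.1 h'.1 fun k hk β => ?_
  have h₁ := h.2 (⟨k, by omega⟩, β)
  have h₂ := h'.2 (⟨k, by omega⟩, β)
  have hpos : (0 : ℝ) < (trials K L j (⟨k, by omega⟩, β)).card := by
    rw [card_trials, repetitions]
    exact_mod_cast (by positivity)
  simp only [rounds] at h₁ h₂
  set c : ℝ := ((trials K L j (⟨k, by omega⟩, β)).card : ℝ)
  set u := Real.cos ((2 ^ k + β.toNat : ℕ) * codeAngle a) ^ 2
  set v := Real.cos ((2 ^ k + β.toNat : ℕ) * codeAngle a') ^ 2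
  rw [abs_le] at h₁ h₂ ⊢
  constructor <;> by_contra hc <;> push Not at hc <;> nlinarith [h₁.1, h₁.2, h₂.1, h₂.2]

/-- The factor 6400 makes each exponent -4 (L + (K - k)). One exp(-L) is kept, exp(-3L) ≤ 1/8
absorbs the two tails, the two shifts and the geometric sum, and exp(-4(K - k)) is summable over the
scales. -/
theorem sum_exp_repetitions_le (K L : ℕ) (hL : 1 ≤ L) :
    ∑ p : Fin (K + 1) × Bool, 2 * Real.exp (-((1 / 20) ^ 2 / 4 * (repetitions K L p.1 : ℝ))) ≤
      Real.exp (-L) := by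
  have hexp : Real.exp (-3) ≤ 1 / 8 := by
    rw [Real.exp_neg, ← one_div]
    refine one_div_le_one_div_of_le (by norm_num) ?_
    have h₁ : Real.exp 3 = Real.exp 1 ^ 3 := by
      rw [← Real.exp_nat_mul]
      norm_num
    rw [h₁]
    have h₂ : (2 : ℝ) ≤ Real.exp 1 := by linarith [Real.exp_one_gt_d9]
    calc (8 : ℝ) = 2 ^ 3 := by norm_num
      _ ≤ Real.exp 1 ^ 3 := by gcongr
  have hterm : ∀ k : ℕ, Real.exp (-((1 / 20) ^ 2 / 4 * (repetitions K L k : ℝ))) ≤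
      Real.exp (-L) * (1 / 8) * (1 / 2) ^ (K - k) := by
    intro k
    have h₁ : Real.exp (-((1 / 20) ^ 2 / 4 * (repetitions K L k : ℝ))) =
        Real.exp (-L) * Real.exp (-3) ^ L * Real.exp (-4) ^ (K - k) := by
      rw [← Real.exp_nat_mul, ← Real.exp_nat_mul, ← Real.exp_add, ← Real.exp_add, repetitions]
      congr 1
      push_cast
      ring
    have h₂ : Real.exp (-3) ^ L ≤ 1 / 8 := by
      refine le_trans (pow_le_of_le_one (Real.exp_nonneg _) ?_ (by omega)) hexp
      exact hexp.trans (by norm_num)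
    have h₃ : Real.exp (-4) ≤ 1 / 2 :=
      (Real.exp_le_exp.mpr (by norm_num)).trans (hexp.trans (by norm_num))
    rw [h₁]
    gcongr
  have hgeom : ∑ k ∈ Finset.range (K + 1), (1 / 2 : ℝ) ^ (K - k) ≤ 2 := by
    have := Finset.sum_range_reflect (fun i => (1 / 2 : ℝ) ^ i) (K + 1)
    simp only [Nat.add_sub_cancel] at this
    rw [this]
    exact sum_geometric_two_le _
  calc ∑ p : Fin (K + 1) × Bool, 2 * Real.exp (-((1 / 20) ^ 2 / 4 * (repetitions K L p.1 : ℝ)))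
      ≤ ∑ p : Fin (K + 1) × Bool, 2 * (Real.exp (-L) * (1 / 8) * (1 / 2) ^ (K - p.1.1)) :=
        Finset.sum_le_sum fun p _ => by linarith [hterm p.1]
    _ = Real.exp (-L) / 2 * ∑ k ∈ Finset.range (K + 1), (1 / 2 : ℝ) ^ (K - k) := by
        rw [Fintype.sum_prod_type, Finset.sum_range, Finset.mul_sum]
        refine Finset.sum_congr rfl fun k _ => ?_
        rw [Fintype.sum_bool]
        ring
    _ ≤ Real.exp (-L) / 2 * 2 := by gcongr
    _ = Real.exp (-L) := by ring

/-- The distribution of the measured bits in each run. -/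
def outcomeDist {n m : ℕ} (P : Preparers n m) (K L : ℕ)
    (r : Fin (Fintype.card (RunIndex m K L))) (o : Bits (4 * n + 3)) : ℝ :=
  ‖finalState P (amplifyCircuit n ((Fintype.equivFin (RunIndex m K L)).symm r).1
    (rounds ((Fintype.equivFin (RunIndex m K L)).symm r).2.1)) o‖ ^ 2

theorem estimator_prob {n m : ℕ} (P : Preparers n m) (K L : ℕ) (η : ℝ)
    (E : (Fin m → ℝ) → Prop) : (estimator n m K L η).prob P E =
      productProb (outcomeDist P K L) fun x => E ((estimator n m K L η).post x) := rfl

theorem outcomeDist_nonneg {n m : ℕ} (P : Preparers n m) (K L : ℕ)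
    (r : Fin (Fintype.card (RunIndex m K L))) (o : Bits (4 * n + 3)) :
    0 ≤ outcomeDist P K L r o := sq_nonneg _

theorem sum_outcomeDist {n m : ℕ} (P : Preparers n m) (K L : ℕ)
    (r : Fin (Fintype.card (RunIndex m K L))) : ∑ o, outcomeDist P K L r o = 1 :=
  sum_norm_sq_finalState _ _

section Estimator

variable {N n m K L : ℕ} {P : Preparers n m} {idx : Fin N ↪ Bits n}
  {Y : EuclideanSpace ℝ (Fin N)} {leaf : Fin N → Fin m} {ε : ℝ}

theorem productProb_not_consistent_le (hP : P.Prepare idx Y leaf) (hL : 1 ≤ L) (j : Fin m)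
    (ha : |meanLabel Y leaf j / ‖Y‖| ≤ 1) :
    productProb (outcomeDist P K L)
      (fun x => ¬ Consistent K L j x (meanLabel Y leaf j / ‖Y‖)) ≤ Real.exp (-L) := by
  have hnonneg := outcomeDist_nonneg P K L
  refine le_trans (productProb_mono (F := fun x => ∃ p, 1 / 20 * ((trials K L j p).card : ℝ) <
    |outcomeCount (trials K L j p) (fun _ => false) x - (trials K L j p).card *
      Real.cos (rounds p * codeAngle (meanLabel Y leaf j / ‖Y‖)) ^ 2|) hnonneg ?_) ?_
  · intro x hx
    by_contra h
    push Not at h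
    exact hx ⟨ha, h⟩
  · refine (productProb_exists_le hnonneg _).trans (le_trans (Finset.sum_le_sum fun p _ => ?_)
      (sum_exp_repetitions_le K L hL))
    have h := productProb_lt_abs_outcomeCount_sub_le hnonneg (sum_outcomeDist P K L)
      (trials K L j p) (fun _ => false)
      (μ := Real.cos (rounds p * codeAngle (meanLabel Y leaf j / ‖Y‖)) ^ 2) (δ := 1 / 20) ?_
      (by rw [abs_of_nonneg] <;> norm_num) (by norm_num)
    · rw [card_trials] at h ⊢
      exact h
    · intro r hr
      obtain ⟨i, -, rfl⟩ := Finset.mem_map.mp hr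
      change outcomeDist P K L (Fintype.equivFin (RunIndex m K L) (j, ⟨p, i⟩)) _ = _
      simp only [outcomeDist, Equiv.symm_apply_apply]
      exact norm_sq_finalState_amplifyCircuit hP j ha _

theorem abs_estimator_post_sub_le (hL : 1 ≤ L) (hY : 0 < ‖Y‖) (hK : 3 * ‖Y‖ / ε ≤ 2 ^ K)
    (hε : 0 < ε) (j : Fin m) {x : Fin (Fintype.card (RunIndex m K L)) → Bits (4 * n + 3)}
    (hx : Consistent K L j x (meanLabel Y leaf j / ‖Y‖)) :
    |(estimator n m K L ‖Y‖).post x j - meanLabel Y leaf j| ≤ ε := by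
  have h : ∃ a, Consistent K L j x a := ⟨_, hx⟩
  have hpost : (estimator n m K L ‖Y‖).post x j = ‖Y‖ * h.choose := dif_pos h
  -- The chosen value need not be the true one: both fit the frequencies, hence they are close.
  have h₁ := h.choose_spec.abs_sub_le hL hx
  have e : ‖Y‖ * h.choose - meanLabel Y leaf j =
      ‖Y‖ * (h.choose - meanLabel Y leaf j / ‖Y‖) := by
    field_simp
  rw [hpost, e, abs_mul, abs_of_pos hY]
  calc ‖Y‖ * |h.choose - meanLabel Y leaf j / ‖Y‖| ≤ ‖Y‖ * (3 / 2 ^ K) := by gcongr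
    _ = 3 * ‖Y‖ / 2 ^ K := by ring
    _ ≤ ε := by
      rw [div_le_iff₀ hε] at hK
      rw [div_le_iff₀ (by positivity)]
      linarith

theorem abs_meanLabel_div_norm_le (hY : 0 < ‖Y‖) (j : Fin m) :
    |meanLabel Y leaf j / ‖Y‖| ≤ 1 := by
  rw [abs_div, abs_of_pos hY]
  exact div_le_one_of_le₀ (abs_meanLabel_le Y leaf j) hY.le

theorem le_estimator_prob (hP : P.Prepare idx Y leaf) (hL : 1 ≤ L) (hY : 0 < ‖Y‖)
    (hK : 3 * ‖Y‖ / ε ≤ 2 ^ K) (hε : 0 < ε) (j : Fin m) :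
    1 - Real.exp (-L) ≤ (estimator n m K L ‖Y‖).prob P
      fun est => |est j - meanLabel Y leaf j| ≤ ε := by
  have h := productProb_not_consistent_le (K := K) hP hL j (abs_meanLabel_div_norm_le hY j)
  rw [productProb_not (sum_outcomeDist P K L)] at h
  rw [estimator_prob]
  refine le_trans (by linarith) (productProb_mono (outcomeDist_nonneg P K L) fun x hx => ?_)
  exact abs_estimator_post_sub_le hL hY hK hε j hx

theorem le_estimator_prob_forall (hP : P.Prepare idx Y leaf) (hL : 1 ≤ L) (hY : 0 < ‖Y‖)
    (hK : 3 * ‖Y‖ / ε ≤ 2 ^ K) (hε : 0 < ε) :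
    1 - m * Real.exp (-L) ≤ (estimator n m K L ‖Y‖).prob P
      fun est => ∀ j, |est j - meanLabel Y leaf j| ≤ ε := by
  have h := (productProb_exists_le (outcomeDist_nonneg P K L)
    fun j x => ¬ Consistent K L j x (meanLabel Y leaf j / ‖Y‖)).trans
    (Finset.sum_le_sum fun j _ =>
      productProb_not_consistent_le hP hL j (abs_meanLabel_div_norm_le hY j))
  simp only [← not_forall] at h
  rw [productProb_not (sum_outcomeDist P K L), Finset.sum_const, Finset.card_univ,
    Fintype.card_fin, nsmul_eq_mul] at h
  rw [estimator_prob]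
  refine le_trans (by linarith) (productProb_mono (outcomeDist_nonneg P K L) fun x hx j => ?_)
  exact abs_estimator_post_sub_le hL hY hK hε j (hx j)

end Estimator

/-! ### The running time -/

/-- The added L + K + 2 makes the left side double exactly when K grows by one. -/
theorem sum_two_pow_mul_le {L : ℕ} (hL : 1 ≤ L) (K : ℕ) :
    ∑ k ∈ Finset.range (K + 1), 2 ^ k * (L + (K - k)) + (L + K + 2) ≤ 4 * 2 ^ K * L := by
  induction K with
  | zero =>
    simp
    omega
  | succ K ih =>
    rw [Finset.sum_range_succ']
    have h : ∑ k ∈ Finset.range (K + 1), 2 ^ (k + 1) * (L + (K + 1 - (k + 1))) =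
        2 * ∑ k ∈ Finset.range (K + 1), 2 ^ k * (L + (K - k)) := by
      rw [Finset.mul_sum]
      refine Finset.sum_congr rfl fun k _ => ?_
      rw [Nat.add_sub_add_right, pow_succ]
      ring
    rw [h, pow_succ, pow_zero]
    have : 4 * (2 ^ K * 2) * L = 2 * (4 * 2 ^ K * L) := by ring
    omega

theorem estimator_time_le (n m K L : ℕ) (hL : 1 ≤ L) (η : ℝ) {Tξ TY : ℝ} (hξ : 0 ≤ Tξ)
    (hY : 0 ≤ TY) : (estimator n m K L η).time Tξ TY ≤
      204800 * (10 * n + 12 + 2 * TY + 4 * Tξ) * m * 2 ^ K * L := by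
  set κ : ℝ := 10 * n + 12 + 2 * TY + 4 * Tξ with hκ
  have hκ0 : 0 ≤ κ := by positivity
  have hrun : ∀ p : Fin (K + 1) × Bool,
      ((4 * n + 3 : ℕ) : ℝ) + rounds p * κ ≤ 4 * κ * 2 ^ p.1.1 := by
    intro p
    have h₁ : (rounds p : ℝ) ≤ 2 ^ p.1.1 + 1 := by
      have : rounds p ≤ 2 ^ p.1.1 + 1 := by
        have := Bool.toNat_le p.2
        simp only [rounds]
        omega
      exact_mod_cast this
    have h₂ : (1 : ℝ) ≤ 2 ^ p.1.1 := one_le_pow₀ (by norm_num)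
    have h₃ : ((4 * n + 3 : ℕ) : ℝ) ≤ κ := by
      rw [hκ]
      push_cast
      have : (0 : ℝ) ≤ n := Nat.cast_nonneg n
      linarith
    nlinarith
  have htime : (estimator n m K L η).time Tξ TY = ∑ r : RunIndex m K L,
      (((4 * n + 3 : ℕ) : ℝ) + rounds r.2.1 * κ) := by
    rw [← (Fintype.equivFin (RunIndex m K L)).symm.sum_comp]
    refine Finset.sum_congr rfl fun r _ => ?_
    congr 1
    exact sum_cost_amplifyCircuit n _ _ Tξ TY
  have hnat : ((∑ k ∈ Finset.range (K + 1), 2 ^ k * (L + (K - k)) : ℕ) : ℝ) ≤ 4 * 2 ^ K * L := by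
    have := sum_two_pow_mul_le hL K
    exact_mod_cast (by omega : ∑ k ∈ Finset.range (K + 1), 2 ^ k * (L + (K - k)) ≤ 4 * 2 ^ K * L)
  calc (estimator n m K L η).time Tξ TY
      ≤ ∑ r : RunIndex m K L, 4 * κ * 2 ^ r.2.1.1.1 := by
        rw [htime]
        exact Finset.sum_le_sum fun r _ => hrun r.2.1
    _ = 51200 * κ * m * ((∑ k ∈ Finset.range (K + 1), 2 ^ k * (L + (K - k)) : ℕ) : ℝ) := by
        rw [Fintype.sum_prod_type]
        dsimp only
        rw [Finset.sum_const, Finset.card_univ, Fintype.card_fin,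
          nsmul_eq_mul, Fintype.sum_sigma, Fintype.sum_prod_type, Finset.sum_range]
        push_cast
        rw [Finset.mul_sum, Finset.mul_sum]
        refine Finset.sum_congr rfl fun k _ => ?_
        rw [Fintype.sum_bool]
        simp only [Finset.sum_const, Finset.card_univ, Fintype.card_fin, nsmul_eq_mul]
        simp only [repetitions]
        push_cast
        ring
    _ ≤ 51200 * κ * m * (4 * 2 ^ K * L) := by gcongr
    _ = 204800 * κ * m * 2 ^ K * L := by ring

theorem exists_algorithm (A : ℝ) (n m L : ℕ) (hL : 1 ≤ L) {η ε : ℝ} (hη : 0 < η) (hε : 0 < ε) :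
    ∃ 𝒜 : Algorithm n m,
      (∀ Tξ TY : ℝ, 1 ≤ Tξ → 0 ≤ TY → TY ≤ A * Tξ → (n : ℝ) ≤ A * Tξ →
        𝒜.time Tξ TY ≤ 1228800 * (16 + 12 * |A|) * (Tξ * m * η / ε) * L) ∧
      ∀ (N : ℕ) (idx : Fin N ↪ Bits n) (Y : EuclideanSpace ℝ (Fin N)) (leaf : Fin N → Fin m)
        (P : Preparers n m), ‖Y‖ = η → P.Prepare idx Y leaf →
        (∀ j, 1 - Real.exp (-L) ≤ 𝒜.prob P fun est => |est j - meanLabel Y leaf j| ≤ ε) ∧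
        1 - m * Real.exp (-L) ≤
          𝒜.prob P fun est => ∀ j, |est j - meanLabel Y leaf j| ≤ ε := by
  -- For η ≤ ε the output 0 is accurate enough, since |label_j| ≤ ‖Y‖. No run is allowed here: the
  -- time bound tends to 0 with η / ε.
  by_cases hηε : η ≤ ε
  · refine ⟨⟨0, fun _ => 0, fun _ => [], fun _ _ => 0⟩, fun Tξ TY hξ hY _ _ => ?_,
      fun N idx Y leaf P hYη _ => ?_⟩
    · simp only [Algorithm.time, Finset.univ_eq_empty, Finset.sum_empty]
      positivity
    · have h : ∀ j, |meanLabel Y leaf j| ≤ ε := fun j =>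
        (abs_meanLabel_le Y leaf j).trans (hYη.le.trans hηε)
      have hexp := Real.exp_nonneg (-(L : ℝ))
      constructor
      · intro j
        simp [Algorithm.prob, h j, hexp]
      · have : 0 ≤ (m : ℝ) * Real.exp (-L) := by positivity
        simp [Algorithm.prob, h, this]
  · push Not at hηε
    have h3 : 1 ≤ 3 * η / ε := by
      rw [le_div_iff₀ hε]
      linarith
    -- The scale K + 1 is the one used: 2^(K+1) exceeds 3η/ε, which gives the precision, and is at
    -- most 6η/ε, which gives the time.
    obtain ⟨K, hK₁, hK₂⟩ := exists_nat_pow_near h3 (one_lt_two : (1 : ℝ) < 2)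
    refine ⟨estimator n m (K + 1) L η, fun Tξ TY hξ hY hYA hnA => ?_,
      fun N idx Y leaf P hYη hP => ?_⟩
    · refine (estimator_time_le n m (K + 1) L hL η (by linarith) hY).trans ?_
      have hA : A * Tξ ≤ |A| * Tξ := by
        gcongr
        exact le_abs_self A
      have hκ : 10 * (n : ℝ) + 12 + 2 * TY + 4 * Tξ ≤ (16 + 12 * |A|) * Tξ := by nlinarith
      have h2K : (2 : ℝ) ^ (K + 1) ≤ 6 * (η / ε) := by
        rw [pow_succ]
        have : 3 * η / ε = 3 * (η / ε) := by ring
        linarith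
      calc 204800 * (10 * (n : ℝ) + 12 + 2 * TY + 4 * Tξ) * m * 2 ^ (K + 1) * L
          ≤ 204800 * ((16 + 12 * |A|) * Tξ) * m * (6 * (η / ε)) * L := by gcongr
        _ = 1228800 * (16 + 12 * |A|) * (Tξ * m * η / ε) * L := by ring
    · subst hYη
      exact ⟨le_estimator_prob hP hL hη hK₂.le hε, le_estimator_prob_forall hP hL hη hK₂.le hε⟩

end LeafLabel
end

/-! ### The two time bounds -/

theorem mainTheorem8 (A : ℝ) :
    ∃ C : ℝ, 0 < C ∧ ∀ (N n k D : ℕ) (η ε : ℝ), 0 < η → 0 < ε →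
      (∃ 𝒜 : LeafLabel.Algorithm n (k ^ D),
        (∀ Tξ TY : ℝ, 1 ≤ Tξ → 0 ≤ TY → TY ≤ A * Tξ → (n : ℝ) ≤ A * Tξ →
          𝒜.time Tξ TY ≤ C * (Tξ * (k : ℝ) ^ D * η / ε)) ∧
        ∀ (idx : Fin N ↪ LeafLabel.Bits n) (Y : EuclideanSpace ℝ (Fin N))
          (leaf : Fin N → Fin (k ^ D)) (P : LeafLabel.Preparers n (k ^ D)),
          ‖Y‖ = η → Function.Surjective leaf → P.Prepare idx Y leaf →
          ∀ j, 8 / Real.pi ^ 2 ≤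
            𝒜.prob P fun est => |est j - LeafLabel.meanLabel Y leaf j| ≤ ε) ∧
      (∀ Δ : ℝ, 0 < Δ → Δ ≤ 1 / 2 → ∃ 𝒜 : LeafLabel.Algorithm n (k ^ D),
        (∀ Tξ TY : ℝ, 1 ≤ Tξ → 0 ≤ TY → TY ≤ A * Tξ → (n : ℝ) ≤ A * Tξ →
          𝒜.time Tξ TY ≤ C * (Tξ * (k : ℝ) ^ D * η / ε) * Real.log ((k : ℝ) ^ D / Δ)) ∧
        ∀ (idx : Fin N ↪ LeafLabel.Bits n) (Y : EuclideanSpace ℝ (Fin N))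
          (leaf : Fin N → Fin (k ^ D)) (P : LeafLabel.Preparers n (k ^ D)),
          ‖Y‖ = η → Function.Surjective leaf → P.Prepare idx Y leaf →
          1 - Δ ≤
            𝒜.prob P fun est => ∀ j, |est j - LeafLabel.meanLabel Y leaf j| ≤ ε) := by
  -- The factor 5 covers L = 3 in the first bound. In the second it covers L ≤ log(k^D / Δ) + 2 ≤ 5
  -- log(k^D / Δ), because Δ ≤ 1/2 makes the logarithm at least 1/2 when k^D ≥ 1.
  refine ⟨5 * (1228800 * (16 + 12 * |A|)), by positivity, fun N n k D η ε hη hε => ⟨?_, ?_⟩⟩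
  · obtain ⟨𝒜, htime, hprob⟩ :=
      LeafLabel.exists_algorithm A n (k ^ D) 3 (by norm_num) hη hε
    refine ⟨𝒜, fun Tξ TY hξ hY hYA hnA => ?_, fun idx Y leaf P hYη _ hP j => ?_⟩
    · refine (htime Tξ TY hξ hY hYA hnA).trans ?_
      push_cast
      have : 0 ≤ 1228800 * (16 + 12 * |A|) * (Tξ * (k : ℝ) ^ D * η / ε) := by positivity
      linarith
    · refine le_trans ?_ ((hprob N idx Y leaf P hYη hP).1 j)
      -- With π > 3 this suffices: 8 / π² ≤ 8/9 ≤ 1 - exp(-3).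
      have h₁ : Real.exp (-(3 : ℕ)) ≤ 1 / 9 := by
        rw [Real.exp_neg, ← one_div]
        refine one_div_le_one_div_of_le (by norm_num) ?_
        have h₁ : Real.exp (3 : ℕ) = Real.exp 1 ^ 3 := by
          rw [← Real.exp_nat_mul]
          norm_num
        rw [h₁]
        have h₂ : (27 / 10 : ℝ) ≤ Real.exp 1 := by linarith [Real.exp_one_gt_d9]
        calc (9 : ℝ) ≤ (27 / 10) ^ 3 := by norm_num
          _ ≤ Real.exp 1 ^ 3 := by gcongr
      have h₂ : 8 / Real.pi ^ 2 ≤ 8 / 9 := by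
        have := Real.pi_gt_three
        refine div_le_div_of_nonneg_left (by norm_num) (by norm_num) ?_
        nlinarith
      linarith
  · intro Δ hΔ hΔ'
    -- This L gives k^D exp(-L) ≤ Δ for the union bound over the leaves. The + 1 keeps L ≥ 1 even if
    -- k^D = 0, where the logarithm has the value 0.
    obtain ⟨𝒜, htime, hprob⟩ := LeafLabel.exists_algorithm A n (k ^ D)
      (⌈Real.log ((k : ℝ) ^ D / Δ)⌉₊ + 1) (by omega) hη hε
    refine ⟨𝒜, fun Tξ TY hξ hY hYA hnA => ?_, fun idx Y leaf P hYη _ hP => ?_⟩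
    · refine (htime Tξ TY hξ hY hYA hnA).trans ?_
      push_cast
      rcases Nat.eq_zero_or_pos (k ^ D) with hm | hm
      · have hm' : (k : ℝ) ^ D = 0 := by exact_mod_cast hm
        simp [hm']
      · have hm' : (1 : ℝ) ≤ (k : ℝ) ^ D := by exact_mod_cast hm
        have h₁ : 2 ≤ (k : ℝ) ^ D / Δ := by
          rw [le_div_iff₀ hΔ]
          linarith
        have h₂ : 1 / 2 ≤ Real.log ((k : ℝ) ^ D / Δ) := by
          refine le_trans ?_ (Real.log_le_log (by norm_num) h₁)
          linarith [Real.log_two_gt_d9]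
        have h₃ := Nat.ceil_lt_add_one (a := Real.log ((k : ℝ) ^ D / Δ)) (by linarith)
        have h₄ : 0 ≤ 1228800 * (16 + 12 * |A|) * (Tξ * (k : ℝ) ^ D * η / ε) := by positivity
        calc 1228800 * (16 + 12 * |A|) * (Tξ * (k : ℝ) ^ D * η / ε) *
              ((⌈Real.log ((k : ℝ) ^ D / Δ)⌉₊ : ℝ) + 1)
            ≤ 1228800 * (16 + 12 * |A|) * (Tξ * (k : ℝ) ^ D * η / ε) *
              (5 * Real.log ((k : ℝ) ^ D / Δ)) :=
              mul_le_mul_of_nonneg_left (by linarith) h₄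
          _ = _ := by ring
    · refine le_trans ?_ (hprob N idx Y leaf P hYη hP).2
      rcases Nat.eq_zero_or_pos (k ^ D) with hm | hm
      · simp only [hm, Nat.cast_zero, zero_mul]
        linarith
      · have hm' : (0 : ℝ) < (k : ℝ) ^ D := by exact_mod_cast hm
        have h₁ : Real.log ((k : ℝ) ^ D / Δ) ≤
            ((⌈Real.log ((k : ℝ) ^ D / Δ)⌉₊ + 1 : ℕ) : ℝ) := by
          push_cast
          linarith [Nat.le_ceil (Real.log ((k : ℝ) ^ D / Δ))]
        have h₂ : Real.exp (-((⌈Real.log ((k : ℝ) ^ D / Δ)⌉₊ + 1 : ℕ) : ℝ)) ≤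
            Δ / (k : ℝ) ^ D := by
          refine (Real.exp_le_exp.mpr (neg_le_neg h₁)).trans ?_
          rw [Real.exp_neg, Real.exp_log (by positivity), inv_div]
        have h₃ : ((k ^ D : ℕ) : ℝ) *
            Real.exp (-((⌈Real.log ((k : ℝ) ^ D / Δ)⌉₊ + 1 : ℕ) : ℝ)) ≤ Δ := by
          rw [le_div_iff₀ hm'] at h₂
          rw [Nat.cast_pow]
          linarith
        linarith
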